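/- Let $B=B_0\oplus B_1$ be a commutative superalgebra over $\mathbb R$ (the algebra of parameters, for instance the algebra of smooth functions on a supermanifold, or a Grassmann algebra), with a complete Hausdorff topology defined by submultiplicative seminorms and continuous parity projections. Let $I\subseteq\mathbb R$ be a nonempty open interval. Functions on the superline are $f(x,\xi)=f^0(x)+\xi f^1(x)$ with $x\in I$, $\xi$ odd, and smooth $f^0,f^1:I\to B$; they form a superalgebra $\mathcal F$ and a right module over the constants $B$. Put $D=\partial_\xi+\xi\partial_x$. A monic operator of order $n$ is $M=D^n+a_1D^{n-1}+\dots+a_n$ with $a_i\in\mathcal F$; its kernel $\operatorname{Ker}M\subseteq\mathcal F$ is a right $B$-module. For a square matrix $A$ whose rows and columns, numbered $0,1,2,\dots$, have the parities of their numbers, let $A_{00},A_{01},A_{10},A_{11}$ be the blocks of rows and columns of the given parities, and $$\operatorname{Ber}A=\frac{\det(A_{00}-A_{01}A_{11}^{-1}A_{10})}{\det A_{11}},\qquad \operatorname{Ber}^*A=\frac{\det(A_{11}-A_{10}A_{00}^{-1}A_{01})}{\det A_{00}},$$ defined when $A_{11}$, respectively $A_{00}$, is invertible. The same formulas are used when the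 last column, of an even number for $\operatorname{Ber}$ and of an odd number for $\operatorname{Ber}^*$, has entries of arbitrary parity (in each product its entry is written last). For functions $\varphi_0,\varphi_1,\dots,\varphi_m$ of alternating parities, $\varphi_0$ even, put $W(\varphi_0,\dots,\varphi_m)=\operatorname{Ber}(D^i\varphi_j)_{i,j=0}^m$ and $W^*(\varphi_0,\dots,\varphi_m)=\operatorname{Ber}^*(D^i\varphi_j)_{i,j=0}^m$. Theorem. (1) A monic operator is determined by its kernel: if $M$ and $M'$ are monic operators (of any orders) and $\operatorname{Ker}M=\operatorname{Ker}M'$, then $M=M'$. (2) Let $M$ be a monic operator of order $n\ge 0$ and let $\varphi_0,\dots,\varphi_{n-1}$ be a basis of the right $B$-module $\operatorname{Ker}M$ such that $\varphi_i$ has parity $i\bmod 2$. If $n$ is odd, then $W^*(\varphi_0,\dots,\varphi_{n-1})$ is defined and invertible, and for every odd function $\psi$ the inverse Wronskian $W^*(\varphi_0,\dots,\varphi_{n-1},\psi)$ is defined and $$M\psi=\frac{W^*(\varphi_0,\dots,\varphi_{n-1},\psi)}{W^*(\varphi_0,\dots,\varphi_{n-1})}.$$ If $n$ is even, then $W(\varphi_0,\dots,\varphi_{n-1})$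 is defined and invertible, and for every even function $\phi$ the Wronskian $W(\varphi_0,\dots,\varphi_{n-1},\phi)$ is defined and $$M\phi=\frac{W(\varphi_0,\dots,\varphi_{n-1},\phi)}{W(\varphi_0,\dots,\varphi_{n-1})}.$$ On functions of any parity, $M$ is given by the linear extension of these formulas: for all $f\in\mathcal F$, $$Mf=\sum_{i=0}^{n}c_i\,D^if,$$ where, for $n$ odd (respectively even), $c_i$ is the quotient by $W^*(\varphi_0,\dots,\varphi_{n-1})$ (respectively by $W(\varphi_0,\dots,\varphi_{n-1})$) of $\operatorname{Ber}^*$ (respectively $\operatorname{Ber}$) of the Wroński matrix of $\varphi_0,\dots,\varphi_{n-1},\psi$ in which the last column $(\psi,D\psi,\dots,D^n\psi)$ is replaced by the $i$-th unit vector. -/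

import Mathlib

open Filter Topology MulOpposite

noncomputable section

namespace Superline

/-! ### The algebra of parameters -/

/-- A commutative topological superalgebra over `ℝ`: a `ℤ/2`-graded algebra `B = 𝒜 0 ⊕ 𝒜 1` with
`a b = (-1)^{ij} b a` for `a ∈ 𝒜 i`, `b ∈ 𝒜 j`, with continuous projections to the two summands,
and whose topology is defined by submultiplicative seminorms (local `m`-convexity).
The algebra of smooth functions on a supermanifold, with its Fréchet topology, is
an example, in particular every finite-dimensional Grassmann algebra. -/
class IsParamSuperalgebra {B : Type*} [Ring B] [Algebra ℝ B] [TopologicalSpace B]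
    (𝒜 : ZMod 2 → Submodule ℝ B) [GradedAlgebra 𝒜] : Prop where
  supercomm : ∀ (i j : ZMod 2) (a b : B), a ∈ 𝒜 i → b ∈ 𝒜 j →
    a * b = (-1 : B) ^ (i.val * j.val) * (b * a)
  continuous_proj : ∀ i : ZMod 2, Continuous (GradedAlgebra.proj 𝒜 i)
  mconvex : ∀ U ∈ 𝓝 (0 : B), ∃ q : Seminorm ℝ B, Continuous q ∧
    (∀ a b : B, q (a * b) ≤ q a * q b) ∧ q.ball 0 1 ⊆ U

section Parity

variable {B : Type*} [Ring B] [Algebra ℝ B] (𝒜 : ZMod 2 → Submodule ℝ B) [GradedAlgebra 𝒜]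

/-- The parity involution `b₀ + b₁ ↦ b₀ - b₁`. -/
def parityInv : B →ₗ[ℝ] B := GradedAlgebra.proj 𝒜 0 - GradedAlgebra.proj 𝒜 1

theorem parityInv_of_even {b : B} (hb : b ∈ 𝒜 0) : parityInv 𝒜 b = b := by
  simp [parityInv, DirectSum.decompose_of_mem_same 𝒜 hb,
    DirectSum.decompose_of_mem_ne 𝒜 hb (show (0 : ZMod 2) ≠ 1 by decide)]

theorem parityInv_of_odd {b : B} (hb : b ∈ 𝒜 1) : parityInv 𝒜 b = -b := by
  simp [parityInv, DirectSum.decompose_of_mem_same 𝒜 hb,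
    DirectSum.decompose_of_mem_ne 𝒜 hb (show (1 : ZMod 2) ≠ 0 by decide)]

theorem parityInv_one : parityInv 𝒜 1 = 1 :=
  parityInv_of_even 𝒜 SetLike.GradedOne.one_mem

theorem parityInv_mul_of_mem (i j : ZMod 2) {a b : B} (ha : a ∈ 𝒜 i) (hb : b ∈ 𝒜 j) :
    parityInv 𝒜 (a * b) = parityInv 𝒜 a * parityInv 𝒜 b := by
  have hab : a * b ∈ 𝒜 (i + j) := SetLike.GradedMul.mul_mem ha hb
  have h2 : ∀ k : ZMod 2, k = 0 ∨ k = 1 := by decide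
  rcases h2 i with rfl | rfl <;> rcases h2 j with rfl | rfl
  · rw [parityInv_of_even 𝒜 ha, parityInv_of_even 𝒜 hb, parityInv_of_even 𝒜 hab]
  · rw [parityInv_of_even 𝒜 ha, parityInv_of_odd 𝒜 hb, parityInv_of_odd 𝒜 hab, mul_neg]
  · rw [parityInv_of_odd 𝒜 ha, parityInv_of_even 𝒜 hb, parityInv_of_odd 𝒜 hab, neg_mul]
  · rw [parityInv_of_odd 𝒜 ha, parityInv_of_odd 𝒜 hb, parityInv_of_even 𝒜 hab, neg_mul_neg]

theorem parityInv_mul (a b : B) :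
    parityInv 𝒜 (a * b) = parityInv 𝒜 a * parityInv 𝒜 b := by
  induction a using DirectSum.Decomposition.inductionOn 𝒜 with
  | zero => simp
  | add a a' h h' => rw [add_mul, map_add, h, h', map_add, add_mul]
  | homogeneous a =>
    induction b using DirectSum.Decomposition.inductionOn 𝒜 with
    | zero => simp
    | add b b' h h' => rw [mul_add, map_add, h, h', map_add, mul_add]
    | homogeneous b => exact parityInv_mul_of_mem 𝒜 _ _ a.2 b.2

theorem continuous_parityInv [TopologicalSpace B] [IsTopologicalRing B] [IsParamSuperalgebra 𝒜] :
    Continuous (parityInv 𝒜) :=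
  (IsParamSuperalgebra.continuous_proj (𝒜 := 𝒜) 0).sub
    (IsParamSuperalgebra.continuous_proj (𝒜 := 𝒜) 1)

end Parity

/-! ### Smooth curves in a topological algebra -/

section Smooth

variable {B : Type*} [Ring B] [Algebra ℝ B] [TopologicalSpace B] {I : TopologicalSpace.Opens ℝ}

/-- `f'` is the derivative of `f` on `I`. -/
def HasDer (f f' : I → B) : Prop :=
  ∀ x : I, Tendsto (fun y : I => ((y : ℝ) - (x : ℝ))⁻¹ • (f y - f x)) (𝓝[≠] x) (𝓝 (f' x))

/-- `f` is `n` times continuously differentiable on `I`. -/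
def IsCk : ℕ → (I → B) → Prop
  | 0, f => Continuous f
  | n + 1, f => ∃ f' : I → B, HasDer f f' ∧ IsCk n f'

/-- `f` is smooth on `I`. -/
def IsSmooth (f : I → B) : Prop := ∀ n : ℕ, IsCk n f

theorem hasDer_const (b : B) : HasDer (fun _ : I => b) 0 := fun x => by
  simpa using tendsto_const_nhds

theorem punctured_neBot (x : I) : (𝓝[≠] x).NeBot := by
  rw [neBot_iff, ne_eq, ← isOpen_singleton_iff_punctured_nhds]
  intro h
  have h' := I.isOpen.isOpenMap_subtype_val _ h
  rw [Set.image_singleton] at h'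
  exact not_isOpen_singleton _ h'

theorem HasDer.unique [T2Space B] {f f' f'' : I → B} (h : HasDer f f') (h' : HasDer f f'') :
    f' = f'' := by
  funext x
  haveI := punctured_neBot x
  exact tendsto_nhds_unique (h x) (h' x)

variable [IsTopologicalRing B] [ContinuousSMul ℝ B]

theorem HasDer.continuous {f f' : I → B} (h : HasDer f f') : Continuous f := by
  rw [continuous_iff_continuousAt]
  intro x
  rw [continuousAt_iff_punctured_nhds]
  have h1 : Tendsto (fun y : I => ((y : ℝ) - (x : ℝ))) (𝓝[≠] x) (𝓝 0) := by
    have : Tendsto (fun y : I => ((y : ℝ) - (x : ℝ))) (𝓝 x) (𝓝 ((x : ℝ) - x)) :=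
      (continuous_subtype_val.sub continuous_const).tendsto x
    rw [sub_self] at this
    exact this.mono_left nhdsWithin_le_nhds
  have h2 := (h1.smul (h x)).add_const (f x)
  rw [zero_smul, zero_add] at h2
  refine h2.congr' ?_
  filter_upwards [self_mem_nhdsWithin] with y hy
  have hy' : (y : ℝ) - (x : ℝ) ≠ 0 := sub_ne_zero.2 fun e => hy (Subtype.ext e)
  rw [smul_inv_smul₀ hy', sub_add_cancel]

theorem HasDer.add {f f' g g' : I → B} (hf : HasDer f f') (hg : HasDer g g') :
    HasDer (f + g) (f' + g') := fun x => by
  refine ((hf x).add (hg x)).congr fun y => ?_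
  simp only [Pi.add_apply, ← smul_add]
  congr 1
  abel

theorem HasDer.neg {f f' : I → B} (hf : HasDer f f') : HasDer (-f) (-f') := fun x => by
  refine ((hf x).neg).congr fun y => ?_
  simp only [Pi.neg_apply, ← smul_neg]
  congr 1
  abel

theorem HasDer.mul {f f' g g' : I → B} (hf : HasDer f f') (hg : HasDer g g') :
    HasDer (f * g) (f' * g + f * g') := fun x => by
  have h1 := (hf x).mul ((hg.continuous.tendsto x).mono_left (nhdsWithin_le_nhds (s := {x}ᶜ)))
  have h2 := (tendsto_const_nhds (x := f x)).mul (hg x)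
  refine (h1.add h2).congr fun y => ?_
  simp only [Pi.mul_apply, smul_mul_assoc, mul_smul_comm, ← smul_add]
  congr 1
  noncomm_ring

theorem HasDer.map {f f' : I → B} (hf : HasDer f f') (T : B →ₗ[ℝ] B) (hT : Continuous T) :
    HasDer (fun x => T (f x)) (fun x => T (f' x)) := fun x => by
  refine ((hT.tendsto _).comp (hf x)).congr fun y => ?_
  simp

theorem IsCk.continuous {n : ℕ} {f : I → B} (hf : IsCk n f) : Continuous f := by
  cases n with
  | zero => exact hf
  | succ n => obtain ⟨f', h, -⟩ := hf; exact h.continuous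

theorem IsCk.of_succ {n : ℕ} {f : I → B} (hf : IsCk (n + 1) f) : IsCk n f := by
  induction n generalizing f with
  | zero => exact IsCk.continuous hf
  | succ n ih => obtain ⟨f', h, h'⟩ := hf; exact ⟨f', h, ih h'⟩

theorem isCk_zero (n : ℕ) : IsCk n (0 : I → B) := by
  induction n with
  | zero => exact continuous_const
  | succ n ih => exact ⟨0, hasDer_const 0, ih⟩

theorem isCk_const (n : ℕ) (b : B) : IsCk n (fun _ : I => b) := by
  cases n with
  | zero => exact continuous_const
  | succ n => exact ⟨0, hasDer_const b, isCk_zero n⟩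

theorem IsCk.add {n : ℕ} {f g : I → B} (hf : IsCk n f) (hg : IsCk n g) : IsCk n (f + g) := by
  induction n generalizing f g with
  | zero => exact Continuous.add hf hg
  | succ n ih =>
    obtain ⟨f', h, h'⟩ := hf
    obtain ⟨g', k, k'⟩ := hg
    exact ⟨f' + g', h.add k, ih h' k'⟩

theorem IsCk.neg {n : ℕ} {f : I → B} (hf : IsCk n f) : IsCk n (-f) := by
  induction n generalizing f with
  | zero => exact Continuous.neg hf
  | succ n ih => obtain ⟨f', h, h'⟩ := hf; exact ⟨-f', h.neg, ih h'⟩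

theorem IsCk.mul {n : ℕ} {f g : I → B} (hf : IsCk n f) (hg : IsCk n g) : IsCk n (f * g) := by
  induction n generalizing f g with
  | zero => exact Continuous.mul hf hg
  | succ n ih =>
    have hf0 := hf.of_succ
    have hg0 := hg.of_succ
    obtain ⟨f', h, h'⟩ := hf
    obtain ⟨g', k, k'⟩ := hg
    exact ⟨f' * g + f * g', h.mul k, (ih h' hg0).add (ih hf0 k')⟩

theorem IsCk.map {n : ℕ} {f : I → B} (hf : IsCk n f) (T : B →ₗ[ℝ] B) (hT : Continuous T) :
    IsCk n (fun x => T (f x)) := by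
  induction n generalizing f with
  | zero => exact hT.comp hf
  | succ n ih => obtain ⟨f', h, h'⟩ := hf; exact ⟨_, h.map T hT, ih h'⟩

theorem IsSmooth.exists_hasDer [T2Space B] {f : I → B} (hf : IsSmooth f) :
    ∃ f', HasDer f f' ∧ IsSmooth f' := by
  obtain ⟨f', h, -⟩ := hf 1
  refine ⟨f', h, fun n => ?_⟩
  obtain ⟨g, hg, hg'⟩ := hf (n + 1)
  rwa [h.unique hg]

variable (B I) in
/-- The ring `C^∞(I, B)` of smooth `B`-valued functions of `x ∈ I`. -/
def smoothRing : Subring (I → B) where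
  carrier := {f | IsSmooth f}
  mul_mem' hf hg n := (hf n).mul (hg n)
  one_mem' n := isCk_const n 1
  add_mem' hf hg n := (hf n).add (hg n)
  zero_mem' n := isCk_zero n
  neg_mem' hf n := (hf n).neg

variable [T2Space B]

/-- The derivative `∂ₓ f`. -/
def der (f : smoothRing B I) : smoothRing B I :=
  ⟨f.2.exists_hasDer.choose, f.2.exists_hasDer.choose_spec.2⟩

theorem hasDer_der (f : smoothRing B I) : HasDer (f : I → B) (der f) :=
  f.2.exists_hasDer.choose_spec.1

theorem der_eq {f g : smoothRing B I} (h : HasDer (f : I → B) (g : I → B)) : der f = g :=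
  Subtype.ext ((hasDer_der f).unique h)

end Smooth

/-! ### Functions on the superline -/

section Functions

variable {B : Type*} [Ring B] [Algebra ℝ B] [TopologicalSpace B] [IsTopologicalRing B]
  [ContinuousSMul ℝ B]

/-- A function `f⁰(x) + ξ f¹(x)` on the superline, with coefficients that depend on parameters,
i.e. with `f⁰, f¹ ∈ C^∞(I, B)`. -/
@[ext]
structure SFun (𝒜 : ZMod 2 → Submodule ℝ B) (I : TopologicalSpace.Opens ℝ) where
  /-- `f⁰` -/
  c0 : smoothRing B I
  /-- `f¹` -/
  c1 : smoothRing B I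

variable (𝒜 : ZMod 2 → Submodule ℝ B) [GradedAlgebra 𝒜] [IsParamSuperalgebra 𝒜]
  {I : TopologicalSpace.Opens ℝ}

/-- The parity involution applied to each value. -/
def bar : smoothRing B I →+* smoothRing B I where
  toFun f := ⟨fun x => parityInv 𝒜 (f.1 x),
    fun n => (f.2 n).map (parityInv 𝒜) (continuous_parityInv 𝒜)⟩
  map_one' := Subtype.ext (funext fun _ => parityInv_one 𝒜)
  map_mul' f g := Subtype.ext (funext fun _ => parityInv_mul 𝒜 _ _)
  map_zero' := Subtype.ext (funext fun _ => map_zero _)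
  map_add' f g := Subtype.ext (funext fun _ => map_add _ _ _)

namespace SFun

variable {𝒜}

instance : Zero (SFun 𝒜 I) := ⟨⟨0, 0⟩⟩
instance : One (SFun 𝒜 I) := ⟨⟨1, 0⟩⟩
instance : Add (SFun 𝒜 I) := ⟨fun f g => ⟨f.c0 + g.c0, f.c1 + g.c1⟩⟩
instance : Neg (SFun 𝒜 I) := ⟨fun f => ⟨-f.c0, -f.c1⟩⟩

/-- The product, from `ξ² = 0` and `a ξ = ξ ā`, where `ā` is the parity involution of `a`. -/
instance : Mul (SFun 𝒜 I) := ⟨fun f g => ⟨f.c0 * g.c0, f.c1 * g.c0 + bar 𝒜 f.c0 * g.c1⟩⟩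

@[simp] theorem zero_c0 : (0 : SFun 𝒜 I).c0 = 0 := rfl
@[simp] theorem zero_c1 : (0 : SFun 𝒜 I).c1 = 0 := rfl
@[simp] theorem one_c0 : (1 : SFun 𝒜 I).c0 = 1 := rfl
@[simp] theorem one_c1 : (1 : SFun 𝒜 I).c1 = 0 := rfl
@[simp] theorem add_c0 (f g : SFun 𝒜 I) : (f + g).c0 = f.c0 + g.c0 := rfl
@[simp] theorem add_c1 (f g : SFun 𝒜 I) : (f + g).c1 = f.c1 + g.c1 := rfl
@[simp] theorem neg_c0 (f : SFun 𝒜 I) : (-f).c0 = -f.c0 := rfl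
@[simp] theorem neg_c1 (f : SFun 𝒜 I) : (-f).c1 = -f.c1 := rfl
@[simp] theorem mul_c0 (f g : SFun 𝒜 I) : (f * g).c0 = f.c0 * g.c0 := rfl
@[simp] theorem mul_c1 (f g : SFun 𝒜 I) :
    (f * g).c1 = f.c1 * g.c0 + bar 𝒜 f.c0 * g.c1 := rfl

instance : Ring (SFun 𝒜 I) where
  add_assoc f g h := by ext1 <;> simp [add_assoc]
  zero_add f := by ext1 <;> simp
  add_zero f := by ext1 <;> simp
  add_comm f g := by ext1 <;> simp [add_comm]
  neg_add_cancel f := by ext1 <;> simp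
  mul_assoc f g h := by ext1 <;> simp [mul_assoc, mul_add, add_mul, add_assoc]
  one_mul f := by ext1 <;> simp
  mul_one f := by ext1 <;> simp
  zero_mul f := by ext1 <;> simp
  mul_zero f := by ext1 <;> simp
  left_distrib f g h := by
    ext1
    · simp [mul_add]
    · simp only [mul_c1, add_c0, add_c1, mul_add]; abel
  right_distrib f g h := by
    ext1
    · simp [add_mul]
    · simp only [mul_c1, add_c0, add_c1, add_mul, map_add]; abel
  nsmul := nsmulRec
  zsmul := zsmulRec

/-- The constants `b ∈ B` as functions on the superline. -/
def const : B →+* SFun 𝒜 I where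
  toFun b := ⟨⟨fun _ => b, fun n => isCk_const n b⟩, 0⟩
  map_one' := rfl
  map_mul' a b := by ext1 <;> simp <;> rfl
  map_zero' := rfl
  map_add' a b := by ext1 <;> simp <;> rfl

/-- Functions form a right module over the constants: `op b • f = f * const b`. -/
instance : Module Bᵐᵒᵖ (SFun 𝒜 I) :=
  Module.compHom (SFun 𝒜 I) (RingHom.op (const : B →+* SFun 𝒜 I))

theorem op_smul_def (b : Bᵐᵒᵖ) (f : SFun 𝒜 I) : b • f = f * const (unop b) := rfl

/-- `f` is homogeneous of parity `i`; the coordinate `ξ` is odd. -/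
def HasParity (f : SFun 𝒜 I) (i : ZMod 2) : Prop :=
  ∀ x : I, (f.c0 : I → B) x ∈ 𝒜 i ∧ (f.c1 : I → B) x ∈ 𝒜 (i + 1)

end SFun

/-! ### Differential operators -/

/-- The operator of left multiplication by a function. -/
def lmul {𝒜 : ZMod 2 → Submodule ℝ B} [GradedAlgebra 𝒜] [IsParamSuperalgebra 𝒜]
    (a : SFun 𝒜 I) : Module.End Bᵐᵒᵖ (SFun 𝒜 I) where
  toFun f := a * f
  map_add' f g := mul_add a f g
  map_smul' b f := by simp [SFun.op_smul_def, mul_assoc]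

variable [T2Space B]

/-- The superderivative `D = ∂_ξ + ξ ∂_x`. -/
def superD (𝒜 : ZMod 2 → Submodule ℝ B) [GradedAlgebra 𝒜] [IsParamSuperalgebra 𝒜]
    (I : TopologicalSpace.Opens ℝ) : Module.End Bᵐᵒᵖ (SFun 𝒜 I) where
  toFun f := ⟨f.c1, der f.c0⟩
  map_add' f g := by
    ext1
    · rfl
    · exact der_eq ((hasDer_der f.c0).add (hasDer_der g.c0))
  map_smul' b f := by
    ext1
    · simp [SFun.op_smul_def, SFun.const]
    · have h := (hasDer_der f.c0).mul (hasDer_const (I := I) (unop b))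
      rw [mul_zero, add_zero] at h
      simp only [SFun.op_smul_def, SFun.mul_c0, SFun.mul_c1, RingHom.id_apply]
      rw [der_eq (g := der f.c0 * (SFun.const (𝒜 := 𝒜) (unop b)).c0) h]
      simp [SFun.const]

variable {𝒜}

/-- `M = Dⁿ + ∑_{j < n} a_j D^j`: a monic differential operator of order `n`. -/
def IsMonicOfOrder (n : ℕ) (M : Module.End Bᵐᵒᵖ (SFun 𝒜 I)) : Prop :=
  ∃ a : Fin n → SFun 𝒜 I, M = superD 𝒜 I ^ n + ∑ j : Fin n, lmul (a j) * superD 𝒜 I ^ (j : ℕ)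

/-- The Wroński matrix `(D^i φ_j)`. -/
def wronskiMatrix {n : ℕ} (φ : Fin n → SFun 𝒜 I) : Matrix (Fin n) (Fin n) (SFun 𝒜 I) :=
  Matrix.of fun i j => (superD 𝒜 I ^ (i : ℕ)) (φ j)

end Functions

/-! ### Berezinians

Matrices have the alternating format: the parity of the row or column with number `i` is
`i mod 2`. -/

section Berezinian

variable {R : Type*} [Ring R] {n : ℕ}

/-- The even indices `0, 2, 4, …` below `n`. -/
def evIdx (n : ℕ) (i : Fin ((n + 1) / 2)) : Fin n := ⟨2 * i, by omega⟩

/-- The odd indices `1, 3, 5, …` below `n`. -/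
def odIdx (n : ℕ) (i : Fin (n / 2)) : Fin n := ⟨2 * i + 1, by omega⟩

/-- The even-even block. -/
def block00 (A : Matrix (Fin n) (Fin n) R) := A.submatrix (evIdx n) (evIdx n)
/-- The even-odd block. -/
def block01 (A : Matrix (Fin n) (Fin n) R) := A.submatrix (evIdx n) (odIdx n)
/-- The odd-even block. -/
def block10 (A : Matrix (Fin n) (Fin n) R) := A.submatrix (odIdx n) (evIdx n)
/-- The odd-odd block. -/
def block11 (A : Matrix (Fin n) (Fin n) R) := A.submatrix (odIdx n) (odIdx n)

/-- The determinant `∑_σ sgn(σ) a_{σ(0),0} a_{σ(1),1} ⋯`, the factors in the order of the columns.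
The ring need not be commutative. In a Berezinian all the columns of the matrix, or all but
the last one, have even (hence commuting) entries, so that the order of the factors
plays no role. -/
def colDet {k : ℕ} (A : Matrix (Fin k) (Fin k) R) : R :=
  ∑ σ : Equiv.Perm (Fin k),
    ((Equiv.Perm.sign σ : ℤˣ) : ℤ) • (List.ofFn fun j : Fin k => A (σ j) j).prod

/-- `Ber A = det (A₀₀ - A₀₁ A₁₁⁻¹ A₁₀) / det A₁₁`; it is defined when `A₁₁` is invertible. -/
def ber (A : Matrix (Fin n) (Fin n) R) : R :=
  colDet (block00 A - block01 A * Ring.inverse (block11 A) * block10 A) *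
    Ring.inverse (colDet (block11 A))

/-- The inverse Berezinian `Ber* A = det (A₁₁ - A₁₀ A₀₀⁻¹ A₀₁) / det A₀₀`, the Berezinian of the
parity-reversed matrix; it is defined when `A₀₀` is invertible. -/
def berStar (A : Matrix (Fin n) (Fin n) R) : R :=
  colDet (block11 A - block10 A * Ring.inverse (block00 A) * block01 A) *
    Ring.inverse (colDet (block00 A))

end Berezinian

section Wronskian

variable {B : Type*} [Ring B] [Algebra ℝ B] [TopologicalSpace B] [IsTopologicalRing B]
  [ContinuousSMul ℝ B] [T2Space B] {𝒜 : ZMod 2 → Submodule ℝ B} [GradedAlgebra 𝒜]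
  [IsParamSuperalgebra 𝒜] {I : TopologicalSpace.Opens ℝ} {n : ℕ}

/-- The super Wronskian `W(φ₀, …, φ_{n-1})`. -/
def wr (φ : Fin n → SFun 𝒜 I) : SFun 𝒜 I := ber (wronskiMatrix φ)

/-- The inverse super Wronskian `W*(φ₀, …, φ_{n-1})`. -/
def wrStar (φ : Fin n → SFun 𝒜 I) : SFun 𝒜 I := berStar (wronskiMatrix φ)

/-- The Wroński matrix of `φ₀, …, φ_{n-1}, ψ` with its last column `(ψ, Dψ, …, Dⁿψ)` replaced by
the `i`-th unit vector. Its (inverse) Berezinian is the coefficient of `D^i ψ` in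
the expansion of the (inverse) super Wronskian along the last column. -/
def cofMatrix (φ : Fin n → SFun 𝒜 I) (i : Fin (n + 1)) :
    Matrix (Fin (n + 1)) (Fin (n + 1)) (SFun 𝒜 I) :=
  (wronskiMatrix (Fin.snoc φ 0 : Fin (n + 1) → SFun 𝒜 I)).updateCol (Fin.last n) (Pi.single i 1)

end Wronskian

end Superline

end

/-! The analytic half is an initial value problem. Since `D² = ∂ₓ`, a function `f` with `Mf = 0` is
governed by the values `uᵢ = (Dⁱf)|_{ξ=0}`, `i < n`: comparing the two components of `Dⁿf = -∑
aⱼDʲf` turns the equation into a linear system `u' = Pu` on `I`, with a matrix `P` over `C^∞(I, B)`.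
Picard iteration, estimated separately in each submultiplicative seminorm, solves such systems with
arbitrary initial values (`exists_hasDer_sylvester`), and the fundamental matrix is invertible
(`exists_fundamental_matrix`). A matrix of functions is invertible as soon as its restriction to `ξ
= 0` is, because `ξ² = 0`. Hence `Ker M` contains functions `f₀, …, f_{n-1}` with an invertible
Wroński matrix `W` that restricts to the identity at a chosen point (`exists_fundamental_system`).

Uniqueness of the operator follows: the equations `M fⱼ = 0` say that the row `a` of coefficients
satisfies `aW = -(Dⁿfⱼ)ⱼ`, so `a` is determined when the orders agree. If the orders `n < n'`
differ, a solution of the equation of order `n'` whose only nonzero initial value is `Dⁿf = 1`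
cannot be killed by a monic operator of order `n` unless `1 = 0` in `B`, and then all operators
coincide. Any basis of the kernel is related to `f₀, …, f_{n-1}` by an invertible constant matrix,
so its Wroński matrix is invertible as well (`isUnit_wronskiMatrix_of_basis`).

The other half is algebra over a supercommutative ring. The diagonal blocks of an invertible even
matrix are invertible modulo products of odd elements, which are nilpotent, so the blocks and their
Schur complements are invertible and the Berezinian is a central unit `d`. Border `W` by the row
`Dⁿφⱼ` and the column `(Dⁱψ)ᵢ`. The row vector `(a, 1)` annihilates every column of the bordered
matrix but the last, where it gives `Mψ`. This relation passes to the Schur complement, and a row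
operation on the determinant then yields `Ber = d · Mψ` (`ber_bordered`, `berStar_bordered`). With a
unit vector as last column the same identity isolates one coefficient of `M`. -/

namespace Superline

/-! ### Locally `m`-convex algebras and their Banach quotients -/

/-- The topology is defined by submultiplicative seminorms. -/
class IsMConvex (R : Type*) [Ring R] [Algebra ℝ R] [TopologicalSpace R] : Prop where
  exists_seminorm : ∀ U ∈ 𝓝 (0 : R), ∃ q : Seminorm ℝ R, Continuous q ∧
    (∀ a b : R, q (a * b) ≤ q a * q b) ∧ q.ball 0 1 ⊆ U

section Seminorms

universe u

variable {R : Type u} [Ring R] [Algebra ℝ R]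

/-- The completion of `R` for the single seminorm `q`. Integrals and mean value estimates are
carried out in these Banach spaces; no multiplication on `E` is needed, since products are estimated
by `q` in `R`. -/
theorem exists_banach_quotient [TopologicalSpace R] [IsTopologicalRing R] (q : Seminorm ℝ R)
    (hq : Continuous q) :
    ∃ (E : Type u) (_ : NormedAddCommGroup E) (_ : NormedSpace ℝ E) (_ : CompleteSpace E)
      (π : R →L[ℝ] E), ∀ r, ‖π r‖ = q r := by
  let _ : SeminormedAddCommGroup R := q.toAddGroupSeminorm.toSeminormedAddCommGroup
  let _ : NormedSpace ℝ R := ⟨fun a b => (map_smul_eq_mul q a b).le⟩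
  let T : R →ₗ[ℝ] UniformSpace.Completion R :=
    (UniformSpace.Completion.toComplₗᵢ (𝕜 := ℝ) (E := R)).toLinearMap
  have hT : ∀ r, ‖T r‖ = q r := fun r => UniformSpace.Completion.norm_coe r
  refine ⟨UniformSpace.Completion R, inferInstance, inferInstance, inferInstance, ⟨T, ?_⟩, hT⟩
  rw [continuous_iff_continuousAt]
  intro x
  refine tendsto_iff_norm_sub_tendsto_zero.2 ?_
  have h : Tendsto (fun y => q (y - x)) (@nhds R ‹TopologicalSpace R› x) (𝓝 (q (x - x))) :=
    (hq.comp (continuous_id.sub continuous_const)).tendsto x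
  rw [sub_self, map_zero] at h
  refine h.congr fun y => ?_
  rw [← hT, map_sub]
  rfl

variable [TopologicalSpace R] [IsTopologicalRing R] [IsMConvex R]

theorem tendsto_of_seminorm {ι : Type*} {l : Filter ι} {f : ι → R} {a : R}
    (h : ∀ q : Seminorm ℝ R, Continuous q → (∀ a b : R, q (a * b) ≤ q a * q b) →
      Tendsto (fun i => q (f i - a)) l (𝓝 0)) : Tendsto f l (𝓝 a) := by
  rw [← tendsto_sub_nhds_zero_iff]
  intro U hU
  obtain ⟨q, hq, hm, hqU⟩ := IsMConvex.exists_seminorm U hU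
  have := (h q hq hm).eventually (gt_mem_nhds one_pos)
  rw [mem_map]
  filter_upwards [this] with i hi
  exact hqU (by simpa [Seminorm.mem_ball] using hi)

theorem eq_of_seminorm [T2Space R] {a b : R}
    (h : ∀ q : Seminorm ℝ R, Continuous q → (∀ a b : R, q (a * b) ≤ q a * q b) →
      q (a - b) = 0) : a = b := by
  refine tendsto_nhds_unique (f := fun _ : ℕ => a) (l := atTop) tendsto_const_nhds ?_
  refine tendsto_of_seminorm fun q hq hm => ?_
  rw [h q hq hm]
  exact tendsto_const_nhds

end Seminorms

/-- The bound `1` suffices because every neighbourhood of zero contains the unit ball of some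
admissible seminorm. -/
theorem uniformCauchySeqOn_of_seminorm {R : Type*} [Ring R] [Algebra ℝ R] [UniformSpace R]
    [IsUniformAddGroup R] [IsMConvex R] {α : Type*} {u : ℕ → α → R} {s : Set α}
    (h : ∀ q : Seminorm ℝ R, Continuous q → (∀ a b : R, q (a * b) ≤ q a * q b) →
      ∃ N, ∀ m ≥ N, ∀ n ≥ N, ∀ x ∈ s, q (u m x - u n x) < 1) : UniformCauchySeqOn u atTop s := by
  intro V hV
  rw [uniformity_eq_comap_nhds_zero R] at hV
  obtain ⟨U, hU, hUV⟩ := hV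
  obtain ⟨q, hq, hm, hqU⟩ := IsMConvex.exists_seminorm U hU
  obtain ⟨N, hN⟩ := h q hq hm
  filter_upwards [(eventually_ge_atTop N).prod_mk (eventually_ge_atTop N)] with p hp x hx
  refine hUV (hqU ?_)
  have := hN p.2 hp.2 p.1 hp.1 x hx
  simpa [Seminorm.mem_ball] using this

/-! ### Riemann sums -/

section Riemann

/-- The left Riemann sum over `N` equal parts. -/
noncomputable def riemannSum {E : Type*} [AddCommGroup E] [Module ℝ E] (g : ℝ → E) (a b : ℝ)
    (N : ℕ) : E :=
  ∑ k ∈ Finset.range N, ((b - a) / N) • g (a + k * ((b - a) / N))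

/-- Riemann sums transport integrals from the Banach spaces back to the algebra: they are finite
sums, hence compatible with continuous linear maps. -/
theorem tendsto_riemannSum {E : Type*} [NormedAddCommGroup E] [NormedSpace ℝ E]
    [CompleteSpace E] {g : ℝ → E} {a b : ℝ} (hg : ContinuousOn g (Set.uIcc a b)) :
    Tendsto (riemannSum g a b) atTop (𝓝 (∫ t in a..b, g t)) := by
  rw [Metric.tendsto_atTop]
  intro ε hε
  have huc := isCompact_uIcc.uniformContinuousOn_of_continuous hg
  rw [Metric.uniformContinuousOn_iff] at huc
  have hD : 0 < |b - a| + 1 := by positivity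
  -- The summand `1` covers `a = b` and makes the final estimate `ε |b - a| / (|b - a| + 1) < ε`
  -- strict.
  obtain ⟨δ, hδ, hδ'⟩ := huc (ε / (|b - a| + 1)) (by positivity)
  obtain ⟨N₀, hN₀⟩ := exists_nat_gt (|b - a| / δ)
  refine ⟨N₀ + 1, fun N hN => ?_⟩
  have hNpos : (0 : ℝ) < N := by exact_mod_cast (by omega : 0 < N)
  have hh : |(b - a) / N| < δ := by
    rw [abs_div, abs_of_pos hNpos, div_lt_iff₀ hNpos, mul_comm]
    rw [div_lt_iff₀ hδ] at hN₀
    have : (N₀ : ℝ) ≤ N := by exact_mod_cast (by omega : N₀ ≤ N)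
    nlinarith
  set h := (b - a) / N with hhdef
  have hNh : N * h = b - a := by rw [hhdef]; field_simp
  have hmem : ∀ s : ℝ, 0 ≤ s → s ≤ N → a + s * h ∈ Set.uIcc a b := by
    intro s h0 h1
    have hs : s * h = (s / N) * (b - a) := by rw [hhdef]; ring
    have h2 : 0 ≤ s / N := by positivity
    have h3 : s / N ≤ 1 := by rw [div_le_one hNpos]; exact h1
    rw [hs, Set.mem_uIcc]
    rcases le_total a b with hab | hab
    · left; constructor <;> nlinarith
    · right; constructor <;> nlinarith
  have hsub : ∀ k < N, Set.uIcc (a + (k : ℕ) * h) (a + ((k + 1 : ℕ) : ℝ) * h) ⊆ Set.uIcc a b := by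
    intro k hk
    have hk' : ((k + 1 : ℕ) : ℝ) ≤ N := by exact_mod_cast hk
    exact Set.uIcc_subset_uIcc (hmem _ (by positivity) (by push_cast at hk'; linarith))
      (hmem _ (by positivity) hk')
  have hint : ∀ k < N, IntervalIntegrable g MeasureTheory.volume (a + (k : ℕ) * h)
      (a + ((k + 1 : ℕ) : ℝ) * h) := fun k hk => (hg.mono (hsub k hk)).intervalIntegrable
  have hsum := intervalIntegral.sum_integral_adjacent_intervals
    (a := fun k : ℕ => a + (k : ℝ) * h) hint
  have hend : a + (N : ℝ) * h = b := by rw [hNh]; ring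
  simp only [Nat.cast_zero, zero_mul, add_zero, hend] at hsum
  rw [dist_eq_norm, ← hsum, riemannSum, ← Finset.sum_sub_distrib]
  have hterm : ∀ k ∈ Finset.range N, ‖h • g (a + (k : ℝ) * h) -
      ∫ t in (a + (k : ℝ) * h)..(a + ((k + 1 : ℕ) : ℝ) * h), g t‖
        ≤ ε / (|b - a| + 1) * |h| := by
    intro k hk
    rw [Finset.mem_range] at hk
    have hlen : a + ((k + 1 : ℕ) : ℝ) * h - (a + (k : ℝ) * h) = h := by push_cast; ring
    have hc : h • g (a + (k : ℝ) * h) = ∫ _ in (a + (k : ℝ) * h)..(a + ((k + 1 : ℕ) : ℝ) * h),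
        g (a + (k : ℝ) * h) := by
      rw [intervalIntegral.integral_const, hlen]
    rw [hc, ← intervalIntegral.integral_sub (by simp) (hint k hk)]
    have := intervalIntegral.norm_integral_le_of_norm_le_const
      (a := a + (k : ℝ) * h) (b := a + ((k + 1 : ℕ) : ℝ) * h)
      (f := fun t => g (a + (k : ℝ) * h) - g t) (C := ε / (|b - a| + 1)) ?_
    · rwa [hlen] at this
    · intro t ht
      have ht' := Set.uIoc_subset_uIcc ht
      rw [← dist_eq_norm]
      refine (hδ' _ (hsub k hk Set.left_mem_uIcc) _ (hsub k hk ht') ?_).le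
      rw [dist_comm, Real.dist_eq]
      have := Set.abs_sub_left_of_mem_uIcc ht'
      rw [hlen] at this
      linarith
  calc _ ≤ ∑ k ∈ Finset.range N, ε / (|b - a| + 1) * |h| :=
        (norm_sum_le _ _).trans (Finset.sum_le_sum hterm)
    _ = ε / (|b - a| + 1) * |b - a| := by
        rw [Finset.sum_const, Finset.card_range, nsmul_eq_mul, ← hNh, abs_mul,
          abs_of_pos hNpos]
        ring
    _ < ε := by
        rw [div_mul_eq_mul_div, div_lt_iff₀ hD]
        nlinarith

end Riemann

/-! ### Functions on an open interval, extended by zero to the line -/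

section Extend

variable {I : TopologicalSpace.Opens ℝ} {E : Type*}

/-- Extension by zero of a function on `I`. -/
noncomputable def extendZero [Zero E] (f : I → E) : ℝ → E := Function.extend Subtype.val f 0

theorem extendZero_coe [Zero E] (f : I → E) (x : I) : extendZero f x = f x :=
  Subtype.val_injective.extend_apply f 0 x

theorem continuousOn_extendZero [Zero E] [TopologicalSpace E] {f : I → E} (hf : Continuous f) :
    ContinuousOn (extendZero f) I := by
  rw [continuousOn_iff_continuous_domRestrict]
  refine hf.congr fun x => ?_
  exact (extendZero_coe f x).symm

theorem uIcc_subset_of_isConnected (hI : IsConnected (I : Set ℝ)) (x y : I) :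
    Set.uIcc (x : ℝ) y ⊆ I :=
  hI.isPreconnected.ordConnected.uIcc_subset x.2 y.2

theorem exists_Icc_subset (hI : IsConnected (I : Set ℝ)) (x y : I) :
    ∃ α β : ℝ, Set.Icc α β ⊆ I ∧ (x : ℝ) ∈ Set.Ioo α β ∧ (y : ℝ) ∈ Set.Ioo α β := by
  have key : ∀ z : I, ∃ α ∈ I, ∃ β ∈ I, α < (z : ℝ) ∧ (z : ℝ) < β := by
    intro z
    obtain ⟨ε, hε, h⟩ := Metric.isOpen_iff.1 I.isOpen z z.2
    refine ⟨z - ε / 2, h ?_, z + ε / 2, h ?_, by linarith, by linarith⟩ <;>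
    · rw [Metric.mem_ball, Real.dist_eq, abs_lt]
      constructor <;> linarith
  obtain ⟨a, ha, b, hb, hax, hxb⟩ := key x
  obtain ⟨a', ha', b', hb', hay, hyb⟩ := key y
  have h1 : min a a' ∈ I := by rcases min_choice a a' with h | h <;> rw [h] <;> assumption
  have h2 : max b b' ∈ I := by rcases max_choice b b' with h | h <;> rw [h] <;> assumption
  exact ⟨min a a', max b b', hI.isPreconnected.ordConnected.out h1 h2,
    ⟨by simp [hax], by simp [hxb]⟩, ⟨by simp [hay], by simp [hyb]⟩⟩

theorem map_punctured_nhds (x : I) : map Subtype.val (𝓝[≠] x) = 𝓝[≠] (x : ℝ) := by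
  have h := I.isOpen.isOpenEmbedding_subtypeVal.map_nhdsWithin_preimage_eq {(x : ℝ)}ᶜ x
  rw [← h]
  congr 2
  ext y
  exact not_congr Subtype.ext_iff

theorem hasDerivAt_extendZero_iff [NormedAddCommGroup E] [NormedSpace ℝ E] {f : I → E} {x : I}
    {e : E} : HasDerivAt (extendZero f) e x ↔
      Tendsto (fun y : I => ((y : ℝ) - (x : ℝ))⁻¹ • (f y - f x)) (𝓝[≠] x) (𝓝 e) := by
  rw [hasDerivAt_iff_tendsto_slope, ← map_punctured_nhds, tendsto_map'_iff]
  refine tendsto_congr fun y => ?_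
  simp only [slope, Function.comp, extendZero_coe, vsub_eq_sub]

variable {R : Type*} [Ring R] [Algebra ℝ R] [TopologicalSpace R]
  [NormedAddCommGroup E] [NormedSpace ℝ E]

theorem HasDer.hasDerivAt {f f' : I → R} (h : HasDer f f') (π : R →L[ℝ] E) (x : I) :
    HasDerivAt (extendZero fun t => π (f t)) (π (f' x)) x := by
  rw [hasDerivAt_extendZero_iff]
  refine ((π.continuous.tendsto _).comp (h x)).congr fun y => ?_
  simp

end Extend

/-! ### Primitives of continuous curves in a complete locally `m`-convex algebra -/

section Primitive

universe u

variable {R : Type u} [Ring R] [Algebra ℝ R] {I : TopologicalSpace.Opens ℝ}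

theorem hasDer_of_hasDerivAt [TopologicalSpace R] [IsTopologicalRing R] [IsMConvex R]
    {f f' : I → R} (h : ∀ (E : Type u) [NormedAddCommGroup E] [NormedSpace ℝ E] [CompleteSpace E]
      (π : R →L[ℝ] E) (x : I), HasDerivAt (extendZero fun t => π (f t)) (π (f' x)) x) :
    HasDer f f' := by
  intro x
  refine tendsto_of_seminorm fun q hq _ => ?_
  obtain ⟨E, _, _, _, π, hπ⟩ := exists_banach_quotient q hq
  have := hasDerivAt_extendZero_iff.1 (h E π x)
  refine (tendsto_iff_norm_sub_tendsto_zero.1 this).congr fun y => ?_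
  rw [← hπ]
  simp

theorem HasDer.integral_eq [TopologicalSpace R] (hI : IsConnected (I : Set ℝ))
    {f f' : I → R} (h : HasDer f f') (hf' : Continuous f') {E : Type*} [NormedAddCommGroup E]
    [NormedSpace ℝ E] [CompleteSpace E] (π : R →L[ℝ] E) (x y : I) :
    ∫ t in (x : ℝ)..y, extendZero (fun t => π (f' t)) t = π (f y) - π (f x) := by
  have hs := uIcc_subset_of_isConnected hI x y
  rw [intervalIntegral.integral_eq_sub_of_hasDerivAt (f := extendZero fun t => π (f t)),
    extendZero_coe, extendZero_coe]
  · intro t ht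
    have := h.hasDerivAt π ⟨t, hs ht⟩
    rwa [← extendZero_coe (fun t => π (f' t)) ⟨t, hs ht⟩] at this
  · exact ((continuousOn_extendZero (π.continuous.comp hf')).mono hs).intervalIntegrable

/-- The primitive is the limit of the Riemann sums, which are Cauchy in every seminorm because their
images in the Banach completions converge. It is recorded through these images, which turn it into
an ordinary integral. -/
theorem exists_primitive [UniformSpace R] [IsUniformAddGroup R] [IsTopologicalRing R]
    [IsMConvex R] [CompleteSpace R] (hI : IsConnected (I : Set ℝ)) (x₀ : I) {f : I → R}
    (hf : Continuous f) :
    ∃ F : I → R, ∀ (E : Type u) [NormedAddCommGroup E] [NormedSpace ℝ E] [CompleteSpace E]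
      (π : R →L[ℝ] E) (x : I), π (F x) = ∫ t in (x₀ : ℝ)..x, extendZero (fun t => π (f t)) t := by
  have hlim : ∀ (E : Type u) [NormedAddCommGroup E] [NormedSpace ℝ E] [CompleteSpace E]
      (π : R →L[ℝ] E) (x : I), Tendsto (fun N => π (riemannSum (extendZero f) x₀ x N)) atTop
        (𝓝 (∫ t in (x₀ : ℝ)..x, extendZero (fun t => π (f t)) t)) := by
    intro E _ _ _ π x
    have hs := uIcc_subset_of_isConnected hI x₀ x
    refine (tendsto_riemannSum
      ((continuousOn_extendZero (π.continuous.comp hf)).mono hs)).congr fun N => ?_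
    simp only [riemannSum, map_sum, map_smul]
    refine Finset.sum_congr rfl fun k _ => ?_
    congr 1
    -- Outside `I` both extensions vanish, so the position of the sample point need not be checked.
    by_cases ht : (x₀ : ℝ) + k * ((x - x₀) / N) ∈ I
    · exact (extendZero_coe (π ∘ f) ⟨_, ht⟩).trans (congrArg π (extendZero_coe f ⟨_, ht⟩).symm)
    · have hn : ¬ ∃ a : I, (a : ℝ) = (x₀ : ℝ) + k * ((x - x₀) / N) := by
        rintro ⟨a, ha⟩; exact ht (ha ▸ a.2)
      simp [extendZero, Function.extend_apply' _ _ _ hn]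
  have hex : ∀ x : I, ∃ r : R, Tendsto (riemannSum (extendZero f) (x₀ : ℝ) x) atTop (𝓝 r) := by
    intro x
    refine cauchySeq_tendsto_of_complete ?_
    -- A Cauchy sequence is treated as a uniformly Cauchy sequence of functions on a one-point set.
    have huc : UniformCauchySeqOn (fun N (_ : Unit) => riemannSum (extendZero f) (x₀ : ℝ) x N)
        atTop Set.univ := by
      refine uniformCauchySeqOn_of_seminorm fun q hq _ => ?_
      obtain ⟨E, _, _, _, π, hπ⟩ := exists_banach_quotient q hq
      obtain ⟨N, hN⟩ := Metric.cauchySeq_iff.1 (hlim E π x).cauchySeq 1 one_pos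
      refine ⟨N, fun m hm n hn _ _ => ?_⟩
      have := hN m hm n hn
      rwa [dist_eq_norm, ← map_sub, hπ] at this
    exact huc.cauchySeq (Set.mem_univ ())
  choose F hF using hex
  refine ⟨F, fun E _ _ _ π x => ?_⟩
  exact tendsto_nhds_unique ((π.continuous.tendsto _).comp (hF x)) (hlim E π x)

theorem hasDer_of_integral [TopologicalSpace R] [IsTopologicalRing R] [IsMConvex R]
    (hI : IsConnected (I : Set ℝ)) (x₀ : I) (c : R) {f F : I → R} (hf : Continuous f)
    (hF : ∀ (E : Type u) [NormedAddCommGroup E] [NormedSpace ℝ E] [CompleteSpace E]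
      (π : R →L[ℝ] E) (x : I),
        π (F x) = π c + ∫ t in (x₀ : ℝ)..x, extendZero (fun t => π (f t)) t) :
    HasDer F f := by
  refine hasDer_of_hasDerivAt fun E _ _ _ π x => ?_
  have hc := continuousOn_extendZero (π.continuous.comp hf)
  have hs := uIcc_subset_of_isConnected hI x₀ x
  have hx : (I : Set ℝ) ∈ 𝓝 (x : ℝ) := I.isOpen.mem_nhds x.2
  have h := intervalIntegral.integral_hasDerivAt_right (hc.mono hs).intervalIntegrable
    (hc.stronglyMeasurableAtFilter I.isOpen _ x.2) (hc.continuousAt hx)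
  rw [extendZero_coe] at h
  refine (h.const_add (π c)).congr_of_eventuallyEq ?_
  filter_upwards [hx] with y hy
  exact (extendZero_coe (fun t => π (F t)) ⟨y, hy⟩).trans (hF E π ⟨y, hy⟩)

end Primitive

/-! ### The linear differential equation `y' = a y + y b` -/

section LinearODE

universe u

variable {R : Type u} [Ring R] [Algebra ℝ R] {I : TopologicalSpace.Opens ℝ}

theorem exists_bound_on_Icc {f : I → ℝ} (hf : Continuous f) {α β : ℝ}
    (hJ : Set.Icc α β ⊆ I) : ∃ K, 0 ≤ K ∧ ∀ t : I, (t : ℝ) ∈ Set.Icc α β → f t ≤ K := by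
  obtain ⟨K, hK⟩ := isCompact_Icc.exists_bound_of_continuousOn
    ((continuousOn_extendZero hf).mono hJ)
  refine ⟨max K 0, le_max_right _ _, fun t ht => ?_⟩
  have := hK t ht
  rw [extendZero_coe] at this
  exact (le_abs_self _).trans (this.trans (le_max_left _ _))

theorem seminorm_sylvester_le {q : Seminorm ℝ R} (hm : ∀ a b : R, q (a * b) ≤ q a * q b)
    {a b y : R} {K : ℝ} (hK : q a + q b ≤ K) : q (a * y + y * b) ≤ K * q y := by
  have h1 := map_add_le_add q (a * y) (y * b)
  have h2 := hm a y
  have h3 := hm y b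
  have h4 := apply_nonneg q y
  nlinarith

/-- The Picard estimate, by induction on `m` from `∫ |t - x₀|^m = |x - x₀|^{m+1} / (m+1)`. It serves
twice: with `d` constant in `m` for uniqueness, and with `d m` the difference of consecutive
iterates for existence. -/
theorem seminorm_iterate_le [TopologicalSpace R] [IsTopologicalRing R] {x₀ : I} {α β : ℝ}
    (hJ : Set.Icc α β ⊆ I)
    (hx₀ : (x₀ : ℝ) ∈ Set.Icc α β) {q : Seminorm ℝ R}
    (hm : ∀ a b : R, q (a * b) ≤ q a * q b) {E : Type*} [NormedAddCommGroup E]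
    [NormedSpace ℝ E] [CompleteSpace E] {π : R →L[ℝ] E} (hπ : ∀ r, ‖π r‖ = q r)
    {a b : I → R} (ha : Continuous a) (hb : Continuous b) {d : ℕ → I → R}
    (hd : ∀ m, Continuous (d m))
    (hstep : ∀ m (x : I), π (d (m + 1) x) =
      ∫ t in (x₀ : ℝ)..x, extendZero (fun t => π (a t * d m t + d m t * b t)) t)
    {K C : ℝ} (hK0 : 0 ≤ K) (hK : ∀ t : I, (t : ℝ) ∈ Set.Icc α β → q (a t) + q (b t) ≤ K)
    (hC : ∀ t : I, (t : ℝ) ∈ Set.Icc α β → q (d 0 t) ≤ C) (m : ℕ) :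
    ∀ t : I, (t : ℝ) ∈ Set.Icc α β →
      q (d m t) ≤ C * ((K * |(t : ℝ) - x₀|) ^ m / m.factorial) := by
  induction m with
  | zero => simpa using hC
  | succ m ih =>
    intro x hx
    have hs : Set.uIcc (x₀ : ℝ) x ⊆ Set.Icc α β := Set.uIcc_subset_Icc hx₀ hx
    rw [← hπ, hstep]
    refine intervalIntegral.norm_integral_le_integral_norm_uIoc.trans ?_
    have hcont : Continuous fun t => π (a t * d m t + d m t * b t) :=
      π.continuous.comp ((ha.mul (hd m)).add ((hd m).mul hb))
    calc _ ≤ ∫ t in Set.uIoc (x₀ : ℝ) x, K * C * K ^ m / m.factorial * |t - x₀| ^ m := by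
          refine MeasureTheory.setIntegral_mono_on ?_ ?_ measurableSet_uIoc ?_
          · exact ((continuousOn_extendZero hcont).mono
              (hs.trans hJ)).norm.intervalIntegrable.def'
          · exact (Continuous.intervalIntegrable (by fun_prop) _ _).def'
          · intro t ht
            have htJ := hs (Set.uIoc_subset_uIcc ht)
            have h1 := extendZero_coe (fun t => π (a t * d m t + d m t * b t)) ⟨t, hJ htJ⟩
            simp only at h1
            rw [h1, hπ]
            refine (seminorm_sylvester_le hm (hK ⟨t, hJ htJ⟩ htJ)).trans ?_
            refine (mul_le_mul_of_nonneg_left (ih ⟨t, hJ htJ⟩ htJ) hK0).trans (le_of_eq ?_)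
            simp only [mul_pow]
            ring
      _ = _ := by
          rw [MeasureTheory.integral_const_mul, integral_pow_abs_sub_uIoc, Nat.factorial_succ,
            mul_pow]
          push_cast
          field_simp
          ring

/-- A solution vanishing at `x₀` is its own Picard iterate, so its seminorm is at most `C (K|x -
x₀|)^m / m!` for every `m`. The two-sided form `ay + yb` covers fundamental matrices, their inverses
and the products of both. -/
theorem eq_zero_of_hasDer [TopologicalSpace R] [IsTopologicalRing R] [T2Space R]
    [ContinuousSMul ℝ R] [IsMConvex R] (hI : IsConnected (I : Set ℝ)) (x₀ : I) {a b y : I → R}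
    (ha : Continuous a) (hb : Continuous b) (hy : HasDer y (a * y + y * b)) (h0 : y x₀ = 0) :
    y = 0 := by
  funext x
  refine eq_of_seminorm fun q hq hm => ?_
  obtain ⟨E, _, _, _, π, hπ⟩ := exists_banach_quotient q hq
  obtain ⟨α, β, hJ, hx₀, hx⟩ := exists_Icc_subset hI x₀ x
  obtain ⟨K, hK0, hK⟩ := exists_bound_on_Icc ((hq.comp ha).add (hq.comp hb)) hJ
  obtain ⟨C, -, hC⟩ := exists_bound_on_Icc (hq.comp hy.continuous) hJ
  have hyc := hy.continuous
  have hb := seminorm_iterate_le (d := fun _ => y) hJ (Set.Ioo_subset_Icc_self hx₀) hm hπ ha hb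
    (fun _ => hyc) (fun m x => ?_) hK0 hK hC
  · have hlim := (FloorSemiring.tendsto_pow_div_factorial_atTop
      (K * |(x : ℝ) - x₀|)).const_mul C
    rw [mul_zero] at hlim
    rw [Pi.zero_apply, sub_zero]
    exact le_antisymm (ge_of_tendsto' hlim fun m => hb m x (Set.Ioo_subset_Icc_self hx))
      (apply_nonneg q _)
  · have := hy.integral_eq hI ((ha.mul hyc).add (hyc.mul hb)) π x₀ x
    rw [h0, map_zero, sub_zero] at this
    exact this.symm

theorem eq_of_hasDer_zero [TopologicalSpace R] [IsTopologicalRing R] [T2Space R]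
    [ContinuousSMul ℝ R] [IsMConvex R] (hI : IsConnected (I : Set ℝ)) (x₀ : I) {y : I → R}
    (hy : HasDer y 0) (x : I) : y x = y x₀ := by
  have h : HasDer (fun x => y x + -y x₀) 0 := by
    have := hy.add (hasDer_const (I := I) (-y x₀))
    rwa [add_zero] at this
  have := eq_zero_of_hasDer (a := 0) (b := 0) (y := fun x => y x + -y x₀) hI x₀
    (continuous_const (y := (0 : R))) (continuous_const (y := (0 : R)))
    (by rwa [zero_mul, mul_zero, add_zero]) (add_neg_cancel _)
  have := congrFun this x
  rwa [Pi.zero_apply, add_neg_eq_zero] at this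

theorem seminorm_sub_le_sum {q : Seminorm ℝ R} {y : ℕ → R} {s : ℕ → ℝ}
    (h : ∀ k, q (y (k + 1) - y k) ≤ s k) (n j : ℕ) :
    q (y (n + j) - y n) ≤ ∑ k ∈ Finset.range (n + j), s k - ∑ k ∈ Finset.range n, s k := by
  induction j with
  | zero => simp
  | succ j ih =>
    have h1 := map_add_le_add q (y (n + j + 1) - y (n + j)) (y (n + j) - y n)
    rw [sub_add_sub_cancel] at h1
    rw [← add_assoc, Finset.sum_range_succ]
    linarith [h (n + j)]

theorem IsSmooth.neg [TopologicalSpace R] [IsTopologicalRing R] [ContinuousSMul ℝ R] {f : I → R}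
    (hf : IsSmooth f) : IsSmooth (-f) := fun n => (hf n).neg

theorem isSmooth_of_hasDer_sylvester [TopologicalSpace R] [IsTopologicalRing R]
    [ContinuousSMul ℝ R] {a b y : I → R} (ha : IsSmooth a) (hb : IsSmooth b)
    (hy : HasDer y (a * y + y * b)) : IsSmooth y := by
  intro n
  induction n with
  | zero => exact hy.continuous
  | succ n ih => exact ⟨_, hy, ((ha n).mul ih).add (ih.mul (hb n))⟩

variable [UniformSpace R] [IsUniformAddGroup R] [IsTopologicalRing R] [ContinuousSMul ℝ R]
  [T2Space R] [CompleteSpace R] [IsMConvex R]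

theorem exists_integral_equation (hI : IsConnected (I : Set ℝ)) (x₀ : I) (c : R) {f : I → R}
    (hf : Continuous f) : ∃ F : I → R, Continuous F ∧
      ∀ (E : Type u) [NormedAddCommGroup E] [NormedSpace ℝ E] [CompleteSpace E]
        (π : R →L[ℝ] E) (x : I),
        π (F x) = π c + ∫ t in (x₀ : ℝ)..x, extendZero (fun t => π (f t)) t := by
  obtain ⟨F, hF⟩ := exists_primitive hI x₀ hf
  have h : ∀ (E : Type u) [NormedAddCommGroup E] [NormedSpace ℝ E] [CompleteSpace E]
        (π : R →L[ℝ] E) (x : I),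
        π (c + F x) = π c + ∫ t in (x₀ : ℝ)..x, extendZero (fun t => π (f t)) t := by
    intro E _ _ _ π x
    rw [map_add, hF]
  exact ⟨_, (hasDer_of_integral hI x₀ c hf h).continuous, h⟩

/-- Picard iteration of the integral equation, started at the constant `c`. The iterates converge
uniformly on compact intervals in each seminorm, and the limit is a fixed point. -/
theorem exists_hasDer_sylvester (hI : IsConnected (I : Set ℝ)) (x₀ : I) (c : R) {a b : I → R}
    (ha : Continuous a) (hb : Continuous b) :
    ∃ y : I → R, HasDer y (a * y + y * b) ∧ y x₀ = c := by
  have hex : ∀ f : {f : I → R // Continuous f}, ∃ F : {F : I → R // Continuous F},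
      ∀ (E : Type u) [NormedAddCommGroup E] [NormedSpace ℝ E] [CompleteSpace E]
        (π : R →L[ℝ] E) (x : I), π (F.1 x) = π c +
          ∫ t in (x₀ : ℝ)..x, extendZero (fun t => π (a t * f.1 t + f.1 t * b t)) t := by
    intro f
    obtain ⟨F, hF, h⟩ := exists_integral_equation hI x₀ c ((ha.mul f.2).add (f.2.mul hb))
    exact ⟨⟨F, hF⟩, h⟩
  choose Φ hΦ using hex
  have hsub : ∀ (f g : {f : I → R // Continuous f}) (E : Type u) [NormedAddCommGroup E]
      [NormedSpace ℝ E] [CompleteSpace E] (π : R →L[ℝ] E) (x : I),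
      π ((Φ f).1 x - (Φ g).1 x) = ∫ t in (x₀ : ℝ)..x,
        extendZero (fun t => π (a t * (f.1 t - g.1 t) + (f.1 t - g.1 t) * b t)) t := by
    intro f g E _ _ _ π x
    have hs := uIcc_subset_of_isConnected hI x₀ x
    have hi : ∀ f : {f : I → R // Continuous f}, IntervalIntegrable
        (extendZero fun t => π (a t * f.1 t + f.1 t * b t)) MeasureTheory.volume (x₀ : ℝ) x :=
      fun f => ((continuousOn_extendZero (π.continuous.comp
        ((ha.mul f.2).add (f.2.mul hb)))).mono hs).intervalIntegrable
    rw [map_sub, hΦ, hΦ, add_sub_add_left_eq_sub, ← intervalIntegral.integral_sub (hi f) (hi g)]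
    refine intervalIntegral.integral_congr fun t ht => ?_
    have e := fun h : I → E => extendZero_coe h ⟨t, hs ht⟩
    simp only at e
    simp only [e]
    rw [← map_sub]
    congr 1
    noncomm_ring
  let Y : ℕ → {f : I → R // Continuous f} := fun m => Φ^[m] ⟨fun _ => c, continuous_const⟩
  have hY : ∀ m, Y (m + 1) = Φ (Y m) := fun m => Function.iterate_succ_apply' Φ m _
  have hcau : ∀ q : Seminorm ℝ R, Continuous q → (∀ a b : R, q (a * b) ≤ q a * q b) →
      ∀ α β : ℝ, Set.Icc α β ⊆ I → (x₀ : ℝ) ∈ Set.Icc α β → ∀ ε > 0, ∃ N, ∀ m ≥ N, ∀ n ≥ N,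
        ∀ t : I, (t : ℝ) ∈ Set.Icc α β → q ((Y m).1 t - (Y n).1 t) < ε := by
    intro q hq hm α β hJ hx₀ ε hε
    obtain ⟨E, _, _, _, π, hπ⟩ := exists_banach_quotient q hq
    obtain ⟨K, hK0, hK⟩ := exists_bound_on_Icc ((hq.comp ha).add (hq.comp hb)) hJ
    obtain ⟨C, hC0, hC⟩ := exists_bound_on_Icc (hq.comp ((Y 1).2.sub (Y 0).2)) hJ
    have hbd := seminorm_iterate_le (d := fun m t => (Y (m + 1)).1 t - (Y m).1 t) hJ hx₀ hm hπ
      ha hb (fun m => (Y (m + 1)).2.sub (Y m).2)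
      (fun m x => by rw [hY (m + 1), ← hsub, ← hY m]) hK0 hK hC
    -- A summable majorant of the increments on the whole interval, from `|t - x₀| ≤ β - α`.
    let s : ℕ → ℝ := fun k => C * ((K * (β - α)) ^ k / k.factorial)
    have hs : Summable s := (Real.summable_pow_div_factorial _).mul_left C
    have hstep : ∀ t : I, (t : ℝ) ∈ Set.Icc α β → ∀ k,
        q ((Y (k + 1)).1 t - (Y k).1 t) ≤ s k := by
      intro t ht k
      refine (hbd k t ht).trans ?_
      have : |(t : ℝ) - x₀| ≤ β - α := abs_sub_le_iff.2
        ⟨by linarith [ht.2, hx₀.1], by linarith [ht.1, hx₀.2]⟩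
      simp only [s]
      gcongr
    obtain ⟨N, hN⟩ := Metric.cauchySeq_iff.1 hs.hasSum.tendsto_sum_nat.cauchySeq ε hε
    refine ⟨N, ?_⟩
    have key : ∀ n ≥ N, ∀ j, ∀ t : I, (t : ℝ) ∈ Set.Icc α β →
        q ((Y (n + j)).1 t - (Y n).1 t) < ε := by
      intro n hn j t ht
      refine (seminorm_sub_le_sum (y := fun k => (Y k).1 t) (hstep t ht) n j).trans_lt ?_
      exact (le_abs_self _).trans_lt (hN (n + j) (by omega) n hn)
    intro m hm' n hn t ht
    rcases le_total n m with h | h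
    · obtain ⟨j, rfl⟩ := Nat.exists_eq_add_of_le h
      exact key n hn j t ht
    · obtain ⟨j, rfl⟩ := Nat.exists_eq_add_of_le h
      rw [map_sub_rev]
      exact key m hm' j t ht
  have huc : ∀ α β : ℝ, Set.Icc α β ⊆ I → (x₀ : ℝ) ∈ Set.Icc α β →
      UniformCauchySeqOn (fun m => (Y m).1) atTop {t : I | (t : ℝ) ∈ Set.Icc α β} :=
    fun α β hJ hx₀ => uniformCauchySeqOn_of_seminorm fun q hq hm =>
      hcau q hq hm α β hJ hx₀ 1 one_pos
  have hlim : ∀ x : I, ∃ r : R, Tendsto (fun m => (Y m).1 x) atTop (𝓝 r) := by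
    intro x
    obtain ⟨α, β, hJ, hx₀, hx⟩ := exists_Icc_subset hI x₀ x
    exact cauchySeq_tendsto_of_complete
      ((huc α β hJ (Set.Ioo_subset_Icc_self hx₀)).cauchySeq (Set.Ioo_subset_Icc_self hx))
  choose y hy using hlim
  have hyc : Continuous y := by
    rw [continuous_iff_continuousAt]
    intro x
    obtain ⟨α, β, hJ, hx₀, hx⟩ := exists_Icc_subset hI x₀ x
    have h1 := (huc α β hJ (Set.Ioo_subset_Icc_self hx₀)).tendstoUniformlyOn_of_tendsto
      (fun x _ => hy x)
    refine (h1.continuousOn (Frequently.of_forall fun m => (Y m).2.continuousOn)).continuousAt ?_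
    exact continuous_subtype_val.continuousAt.preimage_mem_nhds (Icc_mem_nhds hx.1 hx.2)
  -- Compare both sides with a late iterate `Y (N + 1) = Φ (Y N)`. If `Y N` and `Y (N + 1)` are
  -- within `η` of `y`, the error is at most `η + Kη|x - x₀|`; the choice `η = ε / (1 + K|x - x₀|)`
  -- makes it `ε`.
  have hfix : y = (Φ ⟨y, hyc⟩).1 := by
    funext x
    refine eq_of_seminorm fun q hq hm => le_antisymm ?_ (apply_nonneg q _)
    obtain ⟨E, _, _, _, π, hπ⟩ := exists_banach_quotient q hq
    obtain ⟨α, β, hJ, hx₀, hx⟩ := exists_Icc_subset hI x₀ x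
    have hx₀' := Set.Ioo_subset_Icc_self hx₀
    have hx' := Set.Ioo_subset_Icc_self hx
    obtain ⟨K, hK0, hK⟩ := exists_bound_on_Icc ((hq.comp ha).add (hq.comp hb)) hJ
    refine le_of_forall_pos_le_add fun ε hε => ?_
    rw [zero_add]
    have hD : 0 < 1 + K * |(x : ℝ) - x₀| := by positivity
    obtain ⟨N, hN⟩ := hcau q hq hm α β hJ hx₀' (ε / (1 + K * |(x : ℝ) - x₀|)) (by positivity)
    have hle : ∀ m ≥ N, ∀ t : I, (t : ℝ) ∈ Set.Icc α β →
        q ((Y m).1 t - y t) ≤ ε / (1 + K * |(x : ℝ) - x₀|) := by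
      intro m hm' t ht
      have h1 : Tendsto (fun n => q ((Y m).1 t - (Y n).1 t)) atTop (𝓝 (q ((Y m).1 t - y t))) :=
        (hq.tendsto _).comp ((hy t).const_sub ((Y m).1 t))
      refine le_of_tendsto h1 ?_
      filter_upwards [eventually_ge_atTop N] with n hn
      exact (hN m hm' n hn t ht).le
    have h2 : q ((Y (N + 1)).1 x - (Φ ⟨y, hyc⟩).1 x) ≤
        K * (ε / (1 + K * |(x : ℝ) - x₀|)) * |(x : ℝ) - x₀| := by
      rw [hY, ← hπ, hsub]
      refine intervalIntegral.norm_integral_le_of_norm_le_const fun t ht => ?_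
      have htJ := Set.uIcc_subset_Icc hx₀' hx' (Set.uIoc_subset_uIcc ht)
      have e := fun h : I → E => extendZero_coe h ⟨t, hJ htJ⟩
      simp only at e
      rw [e, hπ]
      refine (seminorm_sylvester_le hm (hK ⟨t, hJ htJ⟩ htJ)).trans ?_
      exact mul_le_mul_of_nonneg_left (hle N le_rfl ⟨t, hJ htJ⟩ htJ) hK0
    have h3 := hle (N + 1) (Nat.le_succ N) x hx'
    have h4 := map_add_le_add q (y x - (Y (N + 1)).1 x) ((Y (N + 1)).1 x - (Φ ⟨y, hyc⟩).1 x)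
    rw [sub_add_sub_cancel, map_sub_rev q (y x) ((Y (N + 1)).1 x)] at h4
    refine h4.trans ((add_le_add h3 h2).trans (le_of_eq ?_))
    field_simp
  have hint : ∀ (E : Type u) [NormedAddCommGroup E] [NormedSpace ℝ E] [CompleteSpace E]
      (π : R →L[ℝ] E) (x : I), π (y x) = π c +
        ∫ t in (x₀ : ℝ)..x, extendZero (fun t => π (a t * y t + y t * b t)) t := by
    intro E _ _ _ π x
    conv_lhs => rw [hfix]
    exact hΦ ⟨y, hyc⟩ E π x
  refine ⟨y, hasDer_of_integral hI x₀ c ((ha.mul hyc).add (hyc.mul hb)) hint, ?_⟩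
  refine eq_of_seminorm fun q hq hm => ?_
  obtain ⟨E, _, _, _, π, hπ⟩ := exists_banach_quotient q hq
  rw [← hπ, map_sub, hint]
  simp

end LinearODE

/-! ### Matrices of smooth functions -/

section MatrixFunctions

variable {B : Type*} [Ring B] [Algebra ℝ B] {I : TopologicalSpace.Opens ℝ} {n : ℕ}

theorem exists_nhds_zero_of_entries {B : Type*} [Zero B] {n : ℕ} [TopologicalSpace B]
    {U : Set (Fin n → Fin n → B)}
    (hU : U ∈ 𝓝 (fun _ _ => 0)) : ∃ V ∈ 𝓝 (0 : B), ∀ M, (∀ i j, M i j ∈ V) → M ∈ U := by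
  rw [nhds_pi, Filter.mem_pi'] at hU
  obtain ⟨s, t, ht, hU'⟩ := hU
  have h2 : ∀ i, ∃ V ∈ 𝓝 (0 : B), ∀ v : Fin n → B, (∀ j, v j ∈ V) → v ∈ t i := by
    intro i
    have h := ht i
    rw [nhds_pi, Filter.mem_pi'] at h
    obtain ⟨s', t', ht', h'⟩ := h
    exact ⟨⋂ j, t' j, (Filter.iInter_mem).2 ht',
      fun v hv => h' fun j _ => Set.mem_iInter.1 (hv j) j⟩
  choose V hV hVt using h2
  exact ⟨⋂ i, V i, (Filter.iInter_mem).2 hV,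
    fun M hM => hU' fun i _ => hVt i _ fun j => Set.mem_iInter.1 (hM i j) i⟩

/-- The sum of `q` over all entries is again submultiplicative. Linear systems over `B` thus become
single equations in the noncommutative algebra of matrices. -/
instance [TopologicalSpace B] [IsMConvex B] : IsMConvex (Matrix (Fin n) (Fin n) B) where
  exists_seminorm U hU := by
    obtain ⟨V, hV, hVU⟩ := exists_nhds_zero_of_entries hU
    obtain ⟨q, hq, hm, hqV⟩ := IsMConvex.exists_seminorm V hV
    have hnn : ∀ (M : Matrix (Fin n) (Fin n) B) i j, 0 ≤ q (M i j) :=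
      fun M i j => apply_nonneg q _
    refine ⟨Seminorm.of (fun M : Matrix (Fin n) (Fin n) B => ∑ i, ∑ j, q (M i j)) ?_ ?_,
      ?_, ?_, ?_⟩
    · intro M N
      simp only [← Finset.sum_add_distrib]
      exact Finset.sum_le_sum fun i _ => Finset.sum_le_sum fun j _ => map_add_le_add q _ _
    · intro c M
      simp only [Finset.mul_sum, Matrix.smul_apply, map_smul_eq_mul]
    · change Continuous fun M : Matrix (Fin n) (Fin n) B => ∑ i, ∑ j, q (M i j)
      refine continuous_finsetSum _ fun i _ => continuous_finsetSum _ fun j _ => ?_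
      exact hq.comp ((continuous_apply j).comp (continuous_apply i))
    · intro M N
      change ∑ i, ∑ j, q ((M * N) i j) ≤ (∑ i, ∑ j, q (M i j)) * ∑ i, ∑ j, q (N i j)
      have hrow : ∀ k, ∑ j, q (N k j) ≤ ∑ i, ∑ j, q (N i j) := fun k =>
        Finset.single_le_sum (f := fun k => ∑ j, q (N k j))
          (fun i _ => Finset.sum_nonneg fun j _ => hnn N i j) (Finset.mem_univ k)
      calc _ ≤ ∑ i, ∑ j, ∑ k, q (M i k) * q (N k j) :=
            Finset.sum_le_sum fun i _ => Finset.sum_le_sum fun j _ => by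
              rw [Matrix.mul_apply]
              exact (Finset.le_sum_of_subadditive q (map_zero q).le (map_add_le_add q) _ _).trans
                (Finset.sum_le_sum fun k _ => hm _ _)
        _ = ∑ i, ∑ k, q (M i k) * ∑ j, q (N k j) := by
            refine Finset.sum_congr rfl fun i _ => ?_
            rw [Finset.sum_comm]
            simp only [Finset.mul_sum]
        _ ≤ ∑ i, ∑ k, q (M i k) * ∑ i, ∑ j, q (N i j) :=
            Finset.sum_le_sum fun i _ => Finset.sum_le_sum fun k _ =>
              mul_le_mul_of_nonneg_left (hrow k) (hnn M i k)
        _ = _ := by simp only [Finset.sum_mul]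
    · intro M hM
      rw [Seminorm.mem_ball, sub_zero] at hM
      change ∑ i, ∑ j, q (M i j) < 1 at hM
      refine hVU M fun i j => hqV ?_
      rw [Seminorm.mem_ball, sub_zero]
      refine lt_of_le_of_lt ?_ hM
      exact (Finset.single_le_sum (f := fun j => q (M i j)) (fun j _ => hnn M i j)
        (Finset.mem_univ j)).trans (Finset.single_le_sum (f := fun k => ∑ j, q (M k j))
          (fun i _ => Finset.sum_nonneg fun j _ => hnn M i j) (Finset.mem_univ i))

theorem hasDer_matrix_iff [TopologicalSpace B] {F F' : I → Matrix (Fin n) (Fin n) B} :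
    HasDer F F' ↔ ∀ i j, HasDer (fun x => F x i j) (fun x => F' x i j) := by
  constructor
  · exact fun h i j x => tendsto_pi_nhds.1 (tendsto_pi_nhds.1 (h x) i) j
  · exact fun h x => tendsto_pi_nhds.2 fun i => tendsto_pi_nhds.2 fun j => h i j x

theorem isCk_matrix_iff [TopologicalSpace B] {k : ℕ} {F : I → Matrix (Fin n) (Fin n) B} :
    IsCk k F ↔ ∀ i j, IsCk k (fun x => F x i j) := by
  induction k generalizing F with
  | zero =>
    constructor
    · exact fun h i j => (continuous_apply j).comp ((continuous_apply i).comp h)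
    · exact fun h => continuous_pi fun i => continuous_pi fun j => h i j
  | succ k ih =>
    constructor
    · rintro ⟨F', h, h'⟩ i j
      exact ⟨_, hasDer_matrix_iff.1 h i j, ih.1 h' i j⟩
    · intro h
      choose F' hF' hk using h
      exact ⟨fun x i j => F' i j x, hasDer_matrix_iff.2 hF', ih.2 hk⟩

variable [TopologicalSpace B] [IsTopologicalRing B] [ContinuousSMul ℝ B]

/-- The value of a smooth function at a point. -/
def evalHom (x : I) : smoothRing B I →+* B :=
  (Pi.evalRingHom (fun _ : I => B) x).comp (smoothRing B I).subtype

/-- A matrix of smooth functions as a matrix-valued function. -/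
def evalMatrix (A : Matrix (Fin n) (Fin n) (smoothRing B I)) (x : I) : Matrix (Fin n) (Fin n) B :=
  (evalHom x).mapMatrix A

theorem evalMatrix_mul (A C : Matrix (Fin n) (Fin n) (smoothRing B I)) :
    evalMatrix (A * C) = evalMatrix A * evalMatrix C :=
  funext fun x => map_mul (evalHom x).mapMatrix A C

theorem evalMatrix_injective :
    Function.Injective (evalMatrix : Matrix (Fin n) (Fin n) (smoothRing B I) → _) := by
  intro A C h
  ext i j x
  exact congrFun (congrFun (congrFun h x) i) j

theorem isSmooth_evalMatrix (A : Matrix (Fin n) (Fin n) (smoothRing B I)) :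
    IsSmooth (evalMatrix A) := fun k => isCk_matrix_iff.2 fun i j => (A i j).2 k

theorem exists_evalMatrix_eq {F : I → Matrix (Fin n) (Fin n) B} (hF : IsSmooth F) :
    ∃ A, evalMatrix A = F :=
  ⟨fun i j => ⟨fun x => F x i j, fun k => isCk_matrix_iff.1 (hF k) i j⟩, rfl⟩

end MatrixFunctions

/-! ### Linear systems and their fundamental matrices -/

section Fundamental

variable {B : Type*} [Ring B] [Algebra ℝ B] {I : TopologicalSpace.Opens ℝ} {n : ℕ}

theorem der_eq_mulVec_unique [TopologicalSpace B] [IsTopologicalRing B] [ContinuousSMul ℝ B]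
    [T2Space B] [IsMConvex B] (hI : IsConnected (I : Set ℝ)) (x₀ : I)
    (P : Matrix (Fin n) (Fin n) (smoothRing B I)) {u : Fin n → smoothRing B I}
    (hu : ∀ i, der (u i) = P.mulVec u i) (h0 : ∀ i, (u i : I → B) x₀ = 0) : u = 0 := by
  -- The vector is repeated in every column, so that uniqueness in the matrix algebra applies.
  let U : Matrix (Fin n) (Fin n) (smoothRing B I) := fun i _ => u i
  have hU : HasDer (evalMatrix U) (evalMatrix P * evalMatrix U + evalMatrix U * 0) := by
    rw [mul_zero, add_zero, ← evalMatrix_mul, hasDer_matrix_iff]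
    intro i j
    have h := hasDer_der (u i)
    rw [hu] at h
    exact h
  have hz := eq_zero_of_hasDer hI x₀ ((isSmooth_evalMatrix P) 0) continuous_const hU
    (by ext i j; exact h0 i)
  funext i
  ext x
  exact congrFun (congrFun (congrFun hz x) i) i

/-- The inverse is found as the solution of `Z' = -ZP`. Then `(ZY)' = 0`, while `YZ - 1` solves `w'
= Pw - wP` with zero initial value; no determinant is available over `B`. -/
theorem exists_fundamental_matrix [UniformSpace B] [IsUniformAddGroup B] [IsTopologicalRing B]
    [ContinuousSMul ℝ B] [T2Space B] [CompleteSpace B] [IsMConvex B]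
    (hI : IsConnected (I : Set ℝ)) (x₀ : I) (P : Matrix (Fin n) (Fin n) (smoothRing B I)) :
    ∃ Y Z : Matrix (Fin n) (Fin n) (smoothRing B I), (∀ i j, der (Y i j) = (P * Y) i j) ∧
      evalMatrix Y x₀ = 1 ∧ Y * Z = 1 ∧ Z * Y = 1 := by
  have hP := isSmooth_evalMatrix P
  have h0 : IsSmooth (0 : I → Matrix (Fin n) (Fin n) B) := fun k => isCk_zero k
  obtain ⟨Y', hY', hY0⟩ := exists_hasDer_sylvester hI x₀ (1 : Matrix (Fin n) (Fin n) B) (hP 0)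
    (h0 0)
  obtain ⟨Z', hZ', hZ0⟩ := exists_hasDer_sylvester hI x₀ (1 : Matrix (Fin n) (Fin n) B) (h0 0)
    (hP.neg 0)
  obtain ⟨Y, rfl⟩ := exists_evalMatrix_eq (isSmooth_of_hasDer_sylvester hP h0 hY')
  obtain ⟨Z, rfl⟩ := exists_evalMatrix_eq
    (isSmooth_of_hasDer_sylvester h0 hP.neg hZ')
  rw [mul_zero, add_zero] at hY'
  rw [zero_mul, zero_add, mul_neg] at hZ'
  have h1 : HasDer (evalMatrix Z * evalMatrix Y) 0 := by
    have h := hZ'.mul hY'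
    rwa [neg_mul, mul_assoc, neg_add_cancel] at h
  have h2 : HasDer (evalMatrix Y * evalMatrix Z + fun _ => -1) (evalMatrix P *
      (evalMatrix Y * evalMatrix Z + fun _ => -1) +
      (evalMatrix Y * evalMatrix Z + fun _ => -1) * -evalMatrix P) := by
    have h := (hY'.mul hZ').add (hasDer_const (I := I) (-1 : Matrix (Fin n) (Fin n) B))
    have e : (fun _ => -1 : I → Matrix (Fin n) (Fin n) B) = -1 := rfl
    rw [e] at h ⊢
    have e' : evalMatrix P * (evalMatrix Y * evalMatrix Z + -1) +
        (evalMatrix Y * evalMatrix Z + -1) * -evalMatrix P = evalMatrix P * evalMatrix Y *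
        evalMatrix Z + evalMatrix Y * -(evalMatrix Z * evalMatrix P) + 0 := by noncomm_ring
    rw [e']
    exact h
  refine ⟨Y, Z, fun i j => der_eq ?_, hY0, ?_, ?_⟩
  · rw [← evalMatrix_mul] at hY'
    exact hasDer_matrix_iff.1 hY' i j
  · refine evalMatrix_injective ?_
    have h := eq_zero_of_hasDer hI x₀ (hP 0) (hP.neg 0) h2 (by simp [hY0, hZ0])
    funext x
    have hx := congrFun h x
    rw [evalMatrix_mul, show evalMatrix (1 : Matrix (Fin n) (Fin n) (smoothRing B I)) x = 1 from
      map_one (evalHom x).mapMatrix]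
    exact add_neg_eq_zero.1 hx
  · refine evalMatrix_injective ?_
    funext x
    rw [evalMatrix_mul, eq_of_hasDer_zero hI x₀ h1 x, Pi.mul_apply, hZ0, hY0, one_mul]
    exact (map_one (evalHom x).mapMatrix).symm

end Fundamental

/-! ### The initial value problem for monic operators on the superline -/

section InitialValue

theorem IsParamSuperalgebra.isMConvex {B : Type*} [Ring B] [Algebra ℝ B] [TopologicalSpace B]
    (𝒜 : ZMod 2 → Submodule ℝ B) [GradedAlgebra 𝒜] [IsParamSuperalgebra 𝒜] : IsMConvex B :=
  ⟨IsParamSuperalgebra.mconvex (𝒜 := 𝒜)⟩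

variable {B : Type*} [Ring B] [Algebra ℝ B] [TopologicalSpace B] [IsTopologicalRing B]
  [ContinuousSMul ℝ B] {𝒜 : ZMod 2 → Submodule ℝ B} [GradedAlgebra 𝒜] [IsParamSuperalgebra 𝒜]
  {I : TopologicalSpace.Opens ℝ} {n : ℕ}

/-- The restriction to `ξ = 0`. -/
def SFun.c0Hom : SFun 𝒜 I →+* smoothRing B I where
  toFun := SFun.c0
  map_one' := rfl
  map_mul' _ _ := rfl
  map_zero' := rfl
  map_add' _ _ := rfl

@[simp] theorem SFun.sum_c0 {ι : Type*} (s : Finset ι) (f : ι → SFun 𝒜 I) :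
    (∑ i ∈ s, f i).c0 = ∑ i ∈ s, (f i).c0 := map_sum SFun.c0Hom f s

@[simp] theorem SFun.sum_c1 {ι : Type*} (s : Finset ι) (f : ι → SFun 𝒜 I) :
    (∑ i ∈ s, f i).c1 = ∑ i ∈ s, (f i).c1 :=
  map_sum (⟨⟨SFun.c1, rfl⟩, fun _ _ => rfl⟩ : SFun 𝒜 I →+ smoothRing B I) f s

/-- Functions of `x` as functions on the superline. -/
def SFun.ofSmooth : smoothRing B I →+* SFun 𝒜 I where
  toFun f := ⟨f, 0⟩
  map_one' := rfl
  map_mul' f g := by ext1 <;> simp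
  map_zero' := rfl
  map_add' f g := by ext1 <;> simp

theorem SFun.mul_eq_zero_of_c0 {f g : SFun 𝒜 I} (hf : f.c0 = 0) (hg : g.c0 = 0) : f * g = 0 := by
  ext1 <;> simp [hf, hg]

/-- Functions vanishing at `ξ = 0` multiply to zero, so a matrix restricting to `1` differs from `1`
by a matrix of square zero and is invertible. Applied to `A` times the lift of `Z`, on either side,
this gives a right and a left inverse of `A`. -/
theorem isUnit_matrix_of_c0 {A : Matrix (Fin n) (Fin n) (SFun 𝒜 I)}
    {Z : Matrix (Fin n) (Fin n) (smoothRing B I)} (h1 : A.map SFun.c0 * Z = 1)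
    (h2 : Z * A.map SFun.c0 = 1) : IsUnit A := by
  have hnil : ∀ N : Matrix (Fin n) (Fin n) (SFun 𝒜 I), SFun.c0Hom.mapMatrix N = 1 → IsUnit N := by
    intro N hN
    have h : IsNilpotent (N - 1) := by
      refine ⟨2, ?_⟩
      have h0 : ∀ i j, ((N - 1) i j).c0 = 0 := by
        intro i j
        have h := congrFun (congrFun (map_sub SFun.c0Hom.mapMatrix N 1) i) j
        rw [hN, map_one, sub_self] at h
        exact h
      ext1 i j
      rw [pow_two, Matrix.mul_apply, Matrix.zero_apply]
      exact Finset.sum_eq_zero fun k _ => SFun.mul_eq_zero_of_c0 (h0 i k) (h0 k j)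
    have := h.isUnit_one_add
    rwa [add_sub_cancel] at this
  let Z' : Matrix (Fin n) (Fin n) (SFun 𝒜 I) := SFun.ofSmooth.mapMatrix Z
  have hZ' : SFun.c0Hom.mapMatrix Z' = Z := rfl
  have hA : SFun.c0Hom.mapMatrix A = A.map SFun.c0 := rfl
  obtain ⟨⟨u, ui, hu, -⟩, rfl⟩ := hnil (A * Z') (by rw [map_mul, hZ', hA, h1])
  obtain ⟨v, hv⟩ := hnil (Z' * A) (by rw [map_mul, hZ', hA, h2])
  have hr : A * (Z' * ui) = 1 := by rw [← mul_assoc]; exact hu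
  have hl : (v⁻¹.1 * Z') * A = 1 := by rw [mul_assoc, ← hv]; exact v.inv_mul
  have he := left_inv_eq_right_inv hl hr
  exact ⟨⟨A, _, hr, he ▸ hl⟩, rfl⟩

/-- Expresses `(D^{i+1} f)|_{ξ=0}`, `i < n`, through `(D^i f)|_{ξ=0}` for `f` in the kernel of
`monicOp a`. -/
def compMatrix (a : Fin n → SFun 𝒜 I) : Matrix (Fin n) (Fin n) (smoothRing B I) :=
  fun i j => if (i : ℕ) + 1 < n then (if (j : ℕ) = i + 1 then 1 else 0) else -(a j).c0

/-- The coefficients at `ξ` of `monicOp a`. -/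
def compMatrix' (a : Fin n → SFun 𝒜 I) : Matrix (Fin n) (Fin n) (smoothRing B I) :=
  fun i j => if (i : ℕ) + 1 < n then 0 else (a j).c1

/-- The matrix of the system of ordinary differential equations for `(D^i f)|_{ξ=0}`. -/
def odeMatrix (a : Fin n → SFun 𝒜 I) : Matrix (Fin n) (Fin n) (smoothRing B I) :=
  (compMatrix a).map (bar 𝒜) * compMatrix a - compMatrix' a

theorem compMatrix_mulVec_of_lt (a : Fin n → SFun 𝒜 I) (u : Fin n → smoothRing B I) {i : Fin n}
    (hi : (i : ℕ) + 1 < n) : (compMatrix a).mulVec u i = u ⟨i + 1, hi⟩ := by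
  rw [Matrix.mulVec, dotProduct, Finset.sum_eq_single ⟨i + 1, hi⟩]
  · simp [compMatrix, hi]
  · intro j _ hj
    have : (j : ℕ) ≠ i + 1 := fun h => hj (Fin.ext h)
    simp [compMatrix, hi, this]
  · simp

theorem compMatrix_mulVec_of_not_lt (a : Fin n → SFun 𝒜 I) (u : Fin n → smoothRing B I)
    {i : Fin n} (hi : ¬ (i : ℕ) + 1 < n) :
    (compMatrix a).mulVec u i = -∑ j, (a j).c0 * u j := by
  simp [Matrix.mulVec, dotProduct, compMatrix, hi]

theorem odeMatrix_mulVec_of_lt (a : Fin n → SFun 𝒜 I) (u : Fin n → smoothRing B I) {i : Fin n}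
    (hi : (i : ℕ) + 1 < n) :
    (odeMatrix a).mulVec u i = (compMatrix a).mulVec u ⟨i + 1, hi⟩ := by
  rw [odeMatrix, Matrix.sub_mulVec, ← Matrix.mulVec_mulVec, Pi.sub_apply]
  have h1 : (compMatrix' a).mulVec u i = 0 := by
    simp [Matrix.mulVec, dotProduct, compMatrix', hi]
  rw [h1, sub_zero]
  generalize (compMatrix a).mulVec u = w
  rw [Matrix.mulVec, dotProduct, Finset.sum_eq_single ⟨i + 1, hi⟩]
  · simp [compMatrix, hi]
  · intro j _ hj
    have : (j : ℕ) ≠ i + 1 := fun h => hj (Fin.ext h)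
    simp [compMatrix, hi, this]
  · simp

/-- The right side is the `ξ`-component of `-∑ aⱼ Dʲf`; the involution `bar` appears because `ξ` is
moved to the left past the even component `aⱼ⁰`. -/
theorem odeMatrix_mulVec_of_not_lt (a : Fin n → SFun 𝒜 I) (u : Fin n → smoothRing B I) {i : Fin n}
    (hi : ¬ (i : ℕ) + 1 < n) :
    (odeMatrix a).mulVec u i =
      -∑ j, ((a j).c1 * u j + bar 𝒜 (a j).c0 * (compMatrix a).mulVec u j) := by
  rw [odeMatrix, Matrix.sub_mulVec, ← Matrix.mulVec_mulVec, Pi.sub_apply]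
  generalize (compMatrix a).mulVec u = w
  simp only [Matrix.mulVec, dotProduct, compMatrix', compMatrix, hi, if_false, Matrix.map_apply,
    map_neg, neg_mul, Finset.sum_neg_distrib, Finset.sum_add_distrib]
  abel

variable [T2Space B]

theorem superD_pow_succ_apply (i : ℕ) (f : SFun 𝒜 I) :
    (superD 𝒜 I ^ (i + 1)) f = superD 𝒜 I ((superD 𝒜 I ^ i) f) := by
  rw [pow_succ']
  rfl

theorem superD_c0 (f : SFun 𝒜 I) : (superD 𝒜 I f).c0 = f.c1 := rfl

theorem superD_c1 (f : SFun 𝒜 I) : (superD 𝒜 I f).c1 = der f.c0 := rfl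

theorem superD_pow_mul_const (i : ℕ) (f : SFun 𝒜 I) (c : B) :
    (superD 𝒜 I ^ i) (f * SFun.const c) = (superD 𝒜 I ^ i) f * SFun.const c :=
  map_smul (superD 𝒜 I ^ i) (op c) f

/-- The operator `Dⁿ + ∑ a_j D^j`. -/
noncomputable def monicOp (a : Fin n → SFun 𝒜 I) : Module.End Bᵐᵒᵖ (SFun 𝒜 I) :=
  superD 𝒜 I ^ n + ∑ j : Fin n, lmul (a j) * superD 𝒜 I ^ (j : ℕ)

theorem monicOp_apply (a : Fin n → SFun 𝒜 I) (f : SFun 𝒜 I) :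
    monicOp a f = (superD 𝒜 I ^ n) f + ∑ j : Fin n, a j * (superD 𝒜 I ^ (j : ℕ)) f := by
  simp only [monicOp, LinearMap.add_apply, LinearMap.sum_apply]
  rfl

theorem c1_eq_of_mem_ker {a : Fin n → SFun 𝒜 I} {f : SFun 𝒜 I} (hf : monicOp a f = 0)
    (i : Fin n) : ((superD 𝒜 I ^ (i : ℕ)) f).c1 =
      (compMatrix a).mulVec (fun j => ((superD 𝒜 I ^ (j : ℕ)) f).c0) i := by
  rw [← superD_c0, ← superD_pow_succ_apply]
  by_cases hi : (i : ℕ) + 1 < n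
  · rw [compMatrix_mulVec_of_lt a _ hi]
  · rw [compMatrix_mulVec_of_not_lt a _ hi]
    have h : (i : ℕ) + 1 = n := by omega
    rw [monicOp_apply, add_eq_zero_iff_eq_neg] at hf
    rw [h, hf]
    simp

/-- The derivative of `(Dⁱf)|_{ξ=0}` is the `ξ`-component of `D^{i+1}f`. Below the top order this
component is known from `c1_eq_of_mem_ker`; at the top it is read off from the equation `Dⁿf = -∑
aⱼDʲf`. -/
theorem der_c0_eq_of_mem_ker {a : Fin n → SFun 𝒜 I} {f : SFun 𝒜 I} (hf : monicOp a f = 0)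
    (i : Fin n) : der ((superD 𝒜 I ^ (i : ℕ)) f).c0 =
      (odeMatrix a).mulVec (fun j => ((superD 𝒜 I ^ (j : ℕ)) f).c0) i := by
  rw [← superD_c1, ← superD_pow_succ_apply]
  by_cases hi : (i : ℕ) + 1 < n
  · rw [odeMatrix_mulVec_of_lt a _ hi]
    exact c1_eq_of_mem_ker hf ⟨i + 1, hi⟩
  · rw [odeMatrix_mulVec_of_not_lt a _ hi]
    have h : (i : ℕ) + 1 = n := by omega
    simp only [← c1_eq_of_mem_ker hf]
    rw [monicOp_apply, add_eq_zero_iff_eq_neg] at hf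
    rw [h, hf]
    simp

theorem exists_mem_ker_of_ode (a : Fin n → SFun 𝒜 I) {u : Fin n → smoothRing B I}
    (hu : ∀ i, der (u i) = (odeMatrix a).mulVec u i) :
    ∃ f, monicOp a f = 0 ∧ ∀ i : Fin n, ((superD 𝒜 I ^ (i : ℕ)) f).c0 = u i := by
  rcases Nat.eq_zero_or_pos n with rfl | hn
  · exact ⟨0, map_zero _, fun i => i.elim0⟩
  -- The candidate for `Dⁱf`: its `ξ`-component has to be the value of `D^{i+1}f` at `ξ = 0`.
  let g : Fin n → SFun 𝒜 I := fun i => ⟨u i, (compMatrix a).mulVec u i⟩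
  have hg : ∀ i (hi : i < n), (superD 𝒜 I ^ i) (g ⟨0, hn⟩) = g ⟨i, hi⟩ := by
    intro i
    induction i with
    | zero => intro _; rfl
    | succ i ih =>
      intro hi
      have hi' : i < n := by omega
      rw [superD_pow_succ_apply, ih hi']
      ext1
      · exact compMatrix_mulVec_of_lt a u (i := ⟨i, hi'⟩) hi
      · exact (hu ⟨i, hi'⟩).trans (odeMatrix_mulVec_of_lt a u (i := ⟨i, hi'⟩) hi)
  refine ⟨g ⟨0, hn⟩, ?_, fun i => by rw [hg i i.2]⟩
  have hlast : n - 1 < n := by omega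
  have hnl : ¬ n - 1 + 1 < n := by omega
  have hD : (superD 𝒜 I ^ n) (g ⟨0, hn⟩) = superD 𝒜 I (g ⟨n - 1, hlast⟩) := by
    rw [← hg (n - 1) hlast, ← superD_pow_succ_apply, Nat.sub_add_cancel hn]
  rw [monicOp_apply, hD, add_eq_zero_iff_eq_neg]
  simp only [hg _ (Fin.is_lt _)]
  ext1
  · refine (compMatrix_mulVec_of_not_lt a u (i := ⟨n - 1, hlast⟩) hnl).trans ?_
    simp [g]
  · refine (hu ⟨n - 1, hlast⟩).trans
      ((odeMatrix_mulVec_of_not_lt a u (i := ⟨n - 1, hlast⟩) hnl).trans ?_)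
    simp [g]

theorem eq_zero_of_mem_ker (hI : IsConnected (I : Set ℝ)) (x₀ : I) {a : Fin n → SFun 𝒜 I}
    {f : SFun 𝒜 I} (hf : monicOp a f = 0)
    (h0 : ∀ i : Fin n, (((superD 𝒜 I ^ (i : ℕ)) f).c0 : I → B) x₀ = 0) : f = 0 := by
  have := IsParamSuperalgebra.isMConvex 𝒜
  rcases Nat.eq_zero_or_pos n with rfl | hn
  · rw [monicOp_apply] at hf
    simpa using hf
  have hu := der_eq_mulVec_unique hI x₀ (odeMatrix a) (der_c0_eq_of_mem_ker hf) h0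
  have h1 := c1_eq_of_mem_ker hf ⟨0, hn⟩
  rw [hu, Matrix.mulVec_zero] at h1
  ext1
  · exact congrFun hu ⟨0, hn⟩
  · exact h1

theorem wronskiMatrix_apply (φ : Fin n → SFun 𝒜 I) (i j : Fin n) :
    wronskiMatrix φ i j = (superD 𝒜 I ^ (i : ℕ)) (φ j) := rfl

theorem vecMul_wronskiMatrix_of_mem_ker {a : Fin n → SFun 𝒜 I} {φ : Fin n → SFun 𝒜 I}
    (hφ : ∀ j, monicOp a (φ j) = 0) (j : Fin n) :
    Matrix.vecMul a (wronskiMatrix φ) j = -(superD 𝒜 I ^ n) (φ j) := by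
  have h := hφ j
  rw [monicOp_apply, add_comm, add_eq_zero_iff_eq_neg] at h
  exact h

end InitialValue

/-! ### Fundamental systems in the kernel; an operator is determined by its kernel -/

section Solutions

variable {B : Type*} [Ring B] [Algebra ℝ B] [UniformSpace B] [IsUniformAddGroup B]
  [IsTopologicalRing B] [ContinuousSMul ℝ B] [T2Space B] [CompleteSpace B]
  {𝒜 : ZMod 2 → Submodule ℝ B} [GradedAlgebra 𝒜] [IsParamSuperalgebra 𝒜]
  {I : TopologicalSpace.Opens ℝ} {n : ℕ}

theorem exists_fundamental_system (hI : IsConnected (I : Set ℝ)) (x₀ : I)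
    (a : Fin n → SFun 𝒜 I) :
    ∃ f : Fin n → SFun 𝒜 I, (∀ k, monicOp a (f k) = 0) ∧ IsUnit (wronskiMatrix f) ∧
      ∀ i k, ((wronskiMatrix f i k).c0 : I → B) x₀ = if i = k then 1 else 0 := by
  have := IsParamSuperalgebra.isMConvex 𝒜
  obtain ⟨Y, Z, hY, hY0, hYZ, hZY⟩ := exists_fundamental_matrix hI x₀ (odeMatrix a)
  have h : ∀ k, ∃ f, monicOp a f = 0 ∧
      ∀ i : Fin n, ((superD 𝒜 I ^ (i : ℕ)) f).c0 = Y i k := fun k =>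
    exists_mem_ker_of_ode a fun i => hY i k
  choose f hf hfY using h
  have hW : (wronskiMatrix f).map SFun.c0 = Y := by
    ext1 i k
    exact hfY k i
  refine ⟨f, hf, isUnit_matrix_of_c0 (Z := Z) (by rwa [hW]) (by rwa [hW]), fun i k => ?_⟩
  rw [wronskiMatrix_apply, hfY]
  have := congrFun (congrFun hY0 i) k
  rwa [Matrix.one_apply] at this

theorem monicOp_injective (hI : IsConnected (I : Set ℝ)) {a a' : Fin n → SFun 𝒜 I}
    (h : LinearMap.ker (monicOp a) = LinearMap.ker (monicOp a')) : a = a' := by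
  obtain ⟨x₀, hx₀⟩ := hI.nonempty
  obtain ⟨f, hf, hu, -⟩ := exists_fundamental_system hI ⟨x₀, hx₀⟩ a
  have hf' : ∀ k, monicOp a' (f k) = 0 := by
    intro k
    have : f k ∈ LinearMap.ker (monicOp a) := hf k
    rwa [h] at this
  have h1 : Matrix.vecMul a (wronskiMatrix f) = Matrix.vecMul a' (wronskiMatrix f) := by
    funext j
    rw [vecMul_wronskiMatrix_of_mem_ker hf, vecMul_wronskiMatrix_of_mem_ker hf']
  obtain ⟨w, hw⟩ := hu
  have h2 := congrArg (fun v => Matrix.vecMul v w⁻¹.1) h1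
  simp only [← hw, Matrix.vecMul_vecMul] at h2
  simpa using h2

/-- The fundamental solution number `n` of the higher-order operator has initial values `Dⁿf = 1`
and `Dʲf = 0` for `j < n`. The operator of order `n`, evaluated on it at `x₀` and `ξ = 0`, gives
`1`, which must be `0`. -/
theorem subsingleton_of_ker_monicOp_eq (hI : IsConnected (I : Set ℝ)) {n' : ℕ} (hn : n < n')
    {a : Fin n → SFun 𝒜 I} {a' : Fin n' → SFun 𝒜 I}
    (h : LinearMap.ker (monicOp a) = LinearMap.ker (monicOp a')) : Subsingleton B := by
  obtain ⟨x₀, hx₀⟩ := hI.nonempty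
  obtain ⟨f, hf, -, hf0⟩ := exists_fundamental_system hI ⟨x₀, hx₀⟩ a'
  have hk : f ⟨n, hn⟩ ∈ LinearMap.ker (monicOp a) := h ▸ (hf ⟨n, hn⟩ : _ = _)
  have hk' : monicOp a (f ⟨n, hn⟩) = 0 := hk
  rw [monicOp_apply] at hk'
  have h1 := congrArg (fun g => evalHom ⟨x₀, hx₀⟩ (SFun.c0Hom g)) hk'
  simp only [map_add, map_sum, map_mul, map_zero] at h1
  have h2 : ∀ i : Fin n', evalHom ⟨x₀, hx₀⟩ (SFun.c0Hom ((superD 𝒜 I ^ (i : ℕ)) (f ⟨n, hn⟩))) =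
      if i = ⟨n, hn⟩ then 1 else 0 := fun i => hf0 i _
  have h3 := h2 ⟨n, hn⟩
  rw [if_pos rfl] at h3
  rw [h3, Finset.sum_eq_zero, add_zero] at h1
  · exact subsingleton_of_zero_eq_one h1.symm
  · intro j _
    have := h2 ⟨j, j.2.trans hn⟩
    rw [if_neg (fun e => j.2.ne (congrArg Fin.val e))] at this
    rw [this, mul_zero]

theorem eq_of_ker_eq (hI : IsConnected (I : Set ℝ)) {n n' : ℕ}
    {M M' : Module.End Bᵐᵒᵖ (SFun 𝒜 I)} (hM : IsMonicOfOrder n M) (hM' : IsMonicOfOrder n' M')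
    (h : LinearMap.ker M = LinearMap.ker M') : M = M' := by
  obtain ⟨a, rfl⟩ := hM
  obtain ⟨a', rfl⟩ := hM'
  have hsub : Subsingleton B → superD 𝒜 I ^ n + ∑ j : Fin n, lmul (a j) * superD 𝒜 I ^ (j : ℕ) =
      superD 𝒜 I ^ n' + ∑ j : Fin n', lmul (a' j) * superD 𝒜 I ^ (j : ℕ) := by
    intro _
    refine LinearMap.ext fun f => ?_
    ext x <;> exact Subsingleton.elim _ _
  rcases lt_trichotomy n n' with hn | rfl | hn
  · exact hsub (subsingleton_of_ker_monicOp_eq hI hn h)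
  · rw [monicOp_injective hI h]
  · exact hsub (subsingleton_of_ker_monicOp_eq hI hn h.symm)

/-- Constants pass through `D` on the right, so a change of solutions multiplies the Wroński matrix
by a constant matrix. With `g` the invertible matrix of the fundamental system, `g = WC` and `W =
gE`, and `CE = 1` by linear independence of the basis; hence `C g⁻¹` inverts `W` on both sides. -/
theorem isUnit_wronskiMatrix_of_basis (hI : IsConnected (I : Set ℝ)) (a : Fin n → SFun 𝒜 I)
    (b : Module.Basis (Fin n) Bᵐᵒᵖ (LinearMap.ker (monicOp a))) :
    IsUnit (wronskiMatrix fun i => (b i : SFun 𝒜 I)) := by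
  obtain ⟨x₀, hx₀⟩ := hI.nonempty
  obtain ⟨f, hf, ⟨g, hg⟩, hf0⟩ := exists_fundamental_system hI ⟨x₀, hx₀⟩ a
  set W := wronskiMatrix fun i => (b i : SFun 𝒜 I) with hW
  -- `f` through the basis
  let C : Matrix (Fin n) (Fin n) B := fun j k => unop (b.repr ⟨f k, hf k⟩ j)
  have hfC : ∀ k, f k = ∑ j, (b j : SFun 𝒜 I) * SFun.const (C j k) := by
    intro k
    have h := congrArg Subtype.val (b.sum_repr ⟨f k, hf k⟩)
    rw [AddSubmonoidClass.coe_finsetSum] at h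
    exact h.symm
  -- the basis through `f`
  let E : Matrix (Fin n) (Fin n) B := fun k j =>
    (((superD 𝒜 I ^ (k : ℕ)) (b j)).c0 : I → B) ⟨x₀, hx₀⟩
  have hbE : ∀ j, (b j : SFun 𝒜 I) = ∑ k, f k * SFun.const (E k j) := by
    intro j
    -- The coefficients `E` are the initial values of the basis at `x₀`. Both sides solve the
    -- equation with the same initial values, because the fundamental system starts at the identity.
    rw [← sub_eq_zero]
    refine eq_zero_of_mem_ker (a := a) hI ⟨x₀, hx₀⟩ ?_ fun i => ?_
    · rw [map_sub, map_sum, (b j).2, zero_sub, neg_eq_zero]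
      refine Finset.sum_eq_zero fun k _ => ?_
      have h := map_smul (monicOp a) (op (E k j)) (f k)
      rw [hf, smul_zero] at h
      exact h
    · rw [map_sub, map_sum]
      simp only [superD_pow_mul_const]
      change evalHom ⟨x₀, hx₀⟩ (SFun.c0Hom ((_ : SFun 𝒜 I) - _)) = 0
      have h2 : ∀ k, evalHom ⟨x₀, hx₀⟩ (SFun.c0Hom ((superD 𝒜 I ^ (i : ℕ)) (f k))) =
        if i = k then 1 else 0 := fun k => hf0 i k
      have h3 : ∀ c : B, evalHom ⟨x₀, hx₀⟩ (SFun.c0Hom (SFun.const c : SFun 𝒜 I)) = c :=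
        fun c => rfl
      simp only [map_sub, map_sum, map_mul, h2, h3, ite_mul, one_mul, zero_mul,
        Finset.sum_ite_eq, Finset.mem_univ, if_true]
      exact sub_self _
  have hgC : g.1 = W * SFun.const.mapMatrix C := by
    rw [hg]
    ext1 i k
    rw [wronskiMatrix_apply, hfC, map_sum, Matrix.mul_apply]
    simp only [superD_pow_mul_const]
    rfl
  have hWE : W = g.1 * SFun.const.mapMatrix E := by
    rw [hg]
    ext1 i k
    rw [hW, wronskiMatrix_apply, hbE, map_sum, Matrix.mul_apply]
    simp only [superD_pow_mul_const]
    rfl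
  have hCE : C * E = 1 := by
    have hb : ∀ j, ∑ l, op ((C * E) l j - (1 : Matrix (Fin n) (Fin n) B) l j) • b l = 0 := by
      intro j
      refine Subtype.ext ?_
      rw [AddSubmonoidClass.coe_finsetSum]
      have h1 : (b j : SFun 𝒜 I) = ∑ l, (b l : SFun 𝒜 I) * SFun.const ((C * E) l j) := by
        conv_lhs => rw [hbE j]
        simp only [hfC, Finset.sum_mul, Matrix.mul_apply, map_sum, map_mul, Finset.mul_sum,
          mul_assoc]
        exact Finset.sum_comm
      have h2 : (b j : SFun 𝒜 I) =
          ∑ l, (b l : SFun 𝒜 I) * SFun.const ((1 : Matrix (Fin n) (Fin n) B) l j) := by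
        rw [Finset.sum_eq_single j]
        · simp
        · intro l _ hl
          simp [Matrix.one_apply_ne hl]
        · simp
      calc _ = ∑ l, ((b l : SFun 𝒜 I) * SFun.const ((C * E) l j) -
            (b l : SFun 𝒜 I) * SFun.const ((1 : Matrix (Fin n) (Fin n) B) l j)) := by
            refine Finset.sum_congr rfl fun l _ => ?_
            rw [← mul_sub, ← map_sub]
            rfl
        _ = 0 := by rw [Finset.sum_sub_distrib, ← h1, ← h2, sub_self]
    ext1 l j
    have := Fintype.linearIndependent_iff.1 b.linearIndependent _ (hb j) l
    rw [op_eq_zero_iff] at this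
    exact sub_eq_zero.1 this
  have hr : W * (SFun.const.mapMatrix C * g⁻¹.1) = 1 := by
    rw [← mul_assoc, ← hgC]
    exact g.mul_inv
  have hl : (SFun.const.mapMatrix C * g⁻¹.1) * W = 1 := by
    rw [hWE, mul_assoc, ← mul_assoc g⁻¹.1, Units.inv_mul, one_mul, ← map_mul,
      hCE, map_one]
  exact ⟨⟨W, _, hr, hl⟩, rfl⟩

end Solutions

/-! ### Matrices over a supercommutative ring -/

section SuperRing

variable {R : Type*} [Ring R]

/-- `s` is the parity involution of a supercommutative ring without 2-torsion. -/
structure IsSuperInvolution (s : R →+* R) : Prop where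
  eq_zero_of_add_self : ∀ f : R, f + f = 0 → f = 0
  even_comm : ∀ f, s f = f → ∀ g, g * f = f * g
  odd_anticomm : ∀ f g, s f = -f → s g = -g → f * g = -(g * f)

variable {s : R →+* R}

theorem IsSuperInvolution.mem_center (hs : IsSuperInvolution s) {f : R} (hf : s f = f) :
    f ∈ Subring.center R := Subring.mem_center_iff.2 fun g => hs.even_comm f hf g

theorem IsSuperInvolution.odd_mul_odd_sq (hs : IsSuperInvolution s) {f g : R} (hf : s f = -f)
    (hg : s g = -g) : (f * g) ^ 2 = 0 := by
  have h0 : f * f = 0 := hs.eq_zero_of_add_self _ (by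
    nth_rewrite 1 [hs.odd_anticomm f f hf hf]
    exact neg_add_cancel _)
  calc (f * g) ^ 2 = f * (g * f) * g := by rw [pow_two]; noncomm_ring
    _ = -(f * f) * g * g := by rw [hs.odd_anticomm g f hg hf]; noncomm_ring
    _ = 0 := by rw [h0]; simp

theorem map_eq_iff_entries {m n : Type*} {M : Matrix m n R} :
    M.map s = M ↔ ∀ i j, s (M i j) = M i j := by
  rw [← Matrix.ext_iff]
  rfl

theorem map_eq_neg_iff_entries {m n : Type*} {M : Matrix m n R} :
    M.map s = -M ↔ ∀ i j, s (M i j) = -M i j := by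
  rw [← Matrix.ext_iff]
  rfl

/-- Even elements are central, so matrices with even entries come from the commutative ring
`Subring.center R`, where determinants are available. -/
theorem IsSuperInvolution.exists_lift (hs : IsSuperInvolution s) {m n : Type*} {M : Matrix m n R}
    (hM : M.map s = M) : ∃ M₀ : Matrix m n (Subring.center R),
      M₀.map (Subring.center R).subtype = M :=
  ⟨fun i j => ⟨M i j, hs.mem_center (map_eq_iff_entries.1 hM i j)⟩, rfl⟩

/-- Modulo the nilradical the matrix is the identity, so its determinant is `1` plus a nilpotent. -/
theorem isUnit_one_sub_of_isNilpotent {C : Type*} [CommRing C] {m : Type*} [Fintype m]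
    [DecidableEq m] {N : Matrix m m C} (hN : ∀ i j, IsNilpotent (N i j)) :
    IsUnit (1 - N).det := by
  have h : (1 - N).det - 1 ∈ nilradical C := by
    rw [← Ideal.Quotient.eq, RingHom.map_det]
    have : (Ideal.Quotient.mk (nilradical C)).mapMatrix (1 - N) = 1 := by
      rw [map_sub, map_one, sub_eq_self]
      ext1 i j
      exact Ideal.Quotient.eq_zero_iff_mem.2 (mem_nilradical.2 (hN i j))
    rw [this, Matrix.det_one, map_one]
  have := (mem_nilradical.1 h).isUnit_one_add
  rwa [add_sub_cancel] at this

/-- The hypothesis is a diagonal block of `A A⁻¹ = 1`. The entries of `QN` are sums of products of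
two odd elements, which are central of square zero, so `TX` is the identity minus a matrix with
nilpotent entries and `det T` divides a unit. -/
theorem IsSuperInvolution.isUnit_of_mul_add (hs : IsSuperInvolution s) {m l : Type*} [Fintype m]
    [DecidableEq m] [Fintype l] {T X : Matrix m m R} {Q : Matrix m l R} {N : Matrix l m R}
    (hT : T.map s = T) (hX : X.map s = X) (hQ : Q.map s = -Q) (hN : N.map s = -N)
    (h : Q * N + T * X = 1) : IsUnit T := by
  obtain ⟨T₀, rfl⟩ := hs.exists_lift hT
  obtain ⟨X₀, rfl⟩ := hs.exists_lift hX
  have hnil : ∀ i j, IsNilpotent ((1 - T₀ * X₀) i j) := by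
    intro i j
    have he : ∀ k, Q i k * N k j ∈ Subring.center R := fun k => hs.mem_center (by
      rw [map_mul, map_eq_neg_iff_entries.1 hQ, map_eq_neg_iff_entries.1 hN, neg_mul_neg])
    have h1 : (1 - T₀ * X₀) i j = ∑ k, (⟨Q i k * N k j, he k⟩ : Subring.center R) := by
      refine Subtype.ext ?_
      rw [AddSubmonoidClass.coe_finsetSum, ← Matrix.mul_apply]
      change (Subring.center R).subtype.mapMatrix (1 - T₀ * X₀) i j = _
      rw [map_sub, map_one, map_mul, ← h]
      exact congrFun (congrFun (add_sub_cancel_right _ _) i) j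
    rw [h1, ← mem_nilradical]
    refine sum_mem fun k _ => mem_nilradical.2 ⟨2, Subtype.ext ?_⟩
    exact hs.odd_mul_odd_sq (map_eq_neg_iff_entries.1 hQ i k) (map_eq_neg_iff_entries.1 hN k j)
  have hu := isUnit_one_sub_of_isNilpotent hnil
  rw [sub_sub_cancel, Matrix.det_mul] at hu
  have hT₀ := (Matrix.isUnit_iff_isUnit_det T₀).2 (isUnit_of_mul_isUnit_left hu)
  exact hT₀.map (Subring.center R).subtype.mapMatrix

theorem map_ringInverse {m : Type*} [Fintype m] [DecidableEq m] {T : Matrix m m R}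
    (hT : T.map s = T) (hu : IsUnit T) : (Ring.inverse T).map s = Ring.inverse T := by
  have h1 : (Ring.inverse T).map s * T = 1 := by
    have h2 : (Ring.inverse T).map s * T = (Ring.inverse T).map s * T.map s := by rw [hT]
    rw [h2, ← Matrix.map_mul, Ring.inverse_mul_cancel T hu]
    exact Matrix.map_one s (map_zero s) (map_one s)
  exact left_inv_eq_right_inv h1 (Ring.mul_inverse_cancel T hu)

theorem colDet_map_subtype {k : ℕ} (M : Matrix (Fin k) (Fin k) (Subring.center R)) :
    colDet (M.map (Subring.center R).subtype) = (M.det : R) := by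
  rw [colDet, Matrix.det_apply, AddSubmonoidClass.coe_finsetSum]
  refine Finset.sum_congr rfl fun σ _ => ?_
  rw [← Subring.subtype_apply, Units.smul_def, map_zsmul, ← List.prod_ofFn, map_list_prod,
    List.map_ofFn]
  rfl

theorem IsSuperInvolution.exists_colDet_eq_unit (hs : IsSuperInvolution s) {k : ℕ}
    {M : Matrix (Fin k) (Fin k) R} (hM : M.map s = M) (hu : IsUnit M) :
    ∃ d : (Subring.center R)ˣ, colDet M = ((d : Subring.center R) : R) := by
  have hi := map_ringInverse hM hu
  have h1 := Ring.mul_inverse_cancel M hu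
  generalize Ring.inverse M = X at hi h1
  obtain ⟨M₀, rfl⟩ := hs.exists_lift hM
  obtain ⟨X₀, rfl⟩ := hs.exists_lift hi
  have h2 : M₀ * X₀ = 1 := by
    have hinj : Function.Injective
        ((Subring.center R).subtype.mapMatrix : Matrix (Fin k) (Fin k) _ →+* _) :=
      Matrix.map_injective Subtype.val_injective
    refine hinj ?_
    rw [map_mul, map_one]
    exact h1
  have h3 : M₀.det * X₀.det = 1 := by rw [← Matrix.det_mul, h2, Matrix.det_one]
  exact ⟨Units.mkOfMulEqOne _ _ h3, colDet_map_subtype M₀⟩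

/-- Adding to the last row the other rows with coefficients `aᵢ` leaves the determinant unchanged
and clears the last row except for its final entry. -/
theorem det_snoc_col {C : Type*} [CommRing C] {k : ℕ} (K : Matrix (Fin (k + 1)) (Fin (k + 1)) C)
    (a : Fin k → C)
    (h : ∀ j : Fin k, K (Fin.last k) j.castSucc + ∑ i, a i * K i.castSucc j.castSucc = 0) :
    K.det = (K.submatrix Fin.castSucc Fin.castSucc).det *
      (K (Fin.last k) (Fin.last k) + ∑ i, a i * K i.castSucc (Fin.last k)) := by
  have h1 := Matrix.det_updateRow_sum K (Fin.last k) (Fin.snoc a 1 : Fin (k + 1) → C)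
  rw [Fin.snoc_last, one_smul] at h1
  rw [← h1, Matrix.det_succ_row _ (Fin.last k), Fin.sum_univ_castSucc, Finset.sum_eq_zero, zero_add]
  · have e : ((-1 : C) ^ ((Fin.last k : ℕ) + (Fin.last k : ℕ))) = 1 :=
      Even.neg_one_pow ⟨_, rfl⟩
    rw [e, one_mul, mul_comm]
    congr 1
    · congr 1
      ext i j
      simp [Fin.succAbove_last, Matrix.updateRow_apply]
    · simp [Fin.sum_univ_castSucc, add_comm]
  · intro j _
    have h2 : (∑ i, (Fin.snoc a 1 : Fin (k + 1) → C) i • K i) j.castSucc = 0 := by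
      rw [← h j, Finset.sum_apply, Fin.sum_univ_castSucc, add_comm]
      simp
    rw [Matrix.updateRow_self, h2]
    simp

/-- The factor from the last column stands last in each product, so the expansion along this column
needs no commutation of its entries. The cofactors are determinants over the center, with a unit
vector as last column. -/
theorem colDet_eq_sum_lastCol {k : ℕ} {A : Matrix (Fin (k + 1)) (Fin (k + 1)) R}
    {A₀ : Matrix (Fin (k + 1)) (Fin k) (Subring.center R)}
    (hA : ∀ i j, A i (Fin.castSucc j) = A₀ i j) :
    colDet A = ∑ i, ((Matrix.of fun i' => (Fin.snoc (A₀ i') ((Pi.single i 1 :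
      Fin (k + 1) → Subring.center R) i') : Fin (k + 1) → _)).det : R) * A i (Fin.last k) := by
  simp only [Matrix.det_apply, AddSubmonoidClass.coe_finsetSum, Finset.sum_mul]
  rw [Finset.sum_comm, colDet]
  refine Finset.sum_congr rfl fun σ _ => ?_
  have h1 : ∀ i, (((Equiv.Perm.sign σ • ∏ j, (Matrix.of fun i' => (Fin.snoc (A₀ i')
      ((Pi.single i 1 : Fin (k + 1) → Subring.center R) i') : Fin (k + 1) → _)) (σ j) j :
        Subring.center R)) : R) = if σ (Fin.last k) = i then
        ((Equiv.Perm.sign σ : ℤˣ) : ℤ) • ((∏ j : Fin k, A₀ (σ j.castSucc) j :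
          Subring.center R) : R) else 0 := by
    intro i
    rw [Fin.prod_univ_castSucc]
    simp only [Matrix.of_apply, Fin.snoc_castSucc, Fin.snoc_last, Pi.single_apply, Units.smul_def]
    split_ifs with h
    · rw [mul_one]
      exact map_zsmul (Subring.center R).subtype _ _
    · simp
  simp only [h1, ite_mul, zero_mul, Finset.sum_ite_eq, Finset.mem_univ, if_true]
  rw [List.ofFn_succ', List.concat_eq_append, List.prod_append, List.prod_singleton, smul_mul_assoc]
  congr 2
  change _ = (Subring.center R).subtype _
  rw [← List.prod_ofFn, map_list_prod, List.map_ofFn]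
  congr 2
  funext j
  exact hA _ _

/-- Each cofactor of the last column is evaluated by `det_snoc_col` over the center; this avoids row
operations on entries that do not commute. -/
theorem colDet_snoc_col {k : ℕ} {A : Matrix (Fin (k + 1)) (Fin (k + 1)) R}
    {A₀ : Matrix (Fin (k + 1)) (Fin k) (Subring.center R)}
    (hA : ∀ i j, A i (Fin.castSucc j) = A₀ i j) (a : Fin k → Subring.center R)
    (h : ∀ j : Fin k, A (Fin.last k) j.castSucc + ∑ i, (a i : R) * A i.castSucc j.castSucc = 0) :
    colDet A = colDet (A.submatrix Fin.castSucc Fin.castSucc) *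
      (A (Fin.last k) (Fin.last k) + ∑ i, (a i : R) * A i.castSucc (Fin.last k)) := by
  have hsub : A.submatrix Fin.castSucc Fin.castSucc =
      (A₀.submatrix Fin.castSucc id).map (Subring.center R).subtype := by
    ext i j
    exact hA _ _
  have h' : ∀ j : Fin k, A₀ (Fin.last k) j + ∑ i, a i * A₀ i.castSucc j = 0 := by
    intro j
    refine Subtype.ext ?_
    have := h j
    simp only [hA] at this
    simpa using this
  rw [colDet_eq_sum_lastCol hA, hsub, colDet_map_subtype]
  have hK : ∀ v : Fin (k + 1) → Subring.center R,
      (Matrix.of fun i' => (Fin.snoc (A₀ i') (v i') : Fin (k + 1) → Subring.center R)).det =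
        (A₀.submatrix Fin.castSucc id).det * (v (Fin.last k) + ∑ i, a i * v i.castSucc) := by
    intro v
    rw [det_snoc_col _ a (fun j => by simpa using h' j)]
    congr 1
    · congr 1
      ext i j
      simp
    · simp
  simp only [hK]
  rw [Fin.sum_univ_castSucc, add_comm]
  refine (congrArg₂ (· + ·) ?_ ?_).trans (mul_add _ _ _).symm
  · simp [Fin.castSucc_ne_last]
  · rw [Finset.mul_sum]
    refine Finset.sum_congr rfl fun i _ => ?_
    rw [← mul_assoc]
    congr 1
    simp [Pi.single_apply, (Fin.castSucc_ne_last _).symm]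

end SuperRing

/-! ### Schur complements -/

section Schur

variable {R : Type*} [Ring R] {s : R →+* R} {k p : ℕ}

theorem map_schur {m : Type*} {P : Matrix m (Fin k) R} {Q : Matrix m (Fin p) R}
    {N : Matrix (Fin p) (Fin k) R} {T : Matrix (Fin p) (Fin p) R} (hP : P.map s = P)
    (hQ : Q.map s = -Q) (hN : N.map s = -N) (hT : T.map s = T) (hu : IsUnit T) :
    (P - Q * Ring.inverse T * N).map s = P - Q * Ring.inverse T * N := by
  rw [Matrix.map_sub s (map_sub s), Matrix.map_mul, Matrix.map_mul, hP, hQ, hN,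
    map_ringInverse hT hu]
  simp only [Matrix.neg_mul, Matrix.mul_neg, neg_neg]

/-- The block equations for the inverse show that `P'` is a right inverse of the Schur complement; a
one-sided inverse is enough for a matrix with even entries. -/
theorem IsSuperInvolution.isUnit_schur (hs : IsSuperInvolution s)
    {P P' : Matrix (Fin k) (Fin k) R} {Q Q' : Matrix (Fin k) (Fin p) R}
    {N N' : Matrix (Fin p) (Fin k) R} {T T' : Matrix (Fin p) (Fin p) R}
    (hP : P.map s = P) (hQ : Q.map s = -Q) (hN : N.map s = -N) (hT : T.map s = T)
    (hP' : P'.map s = P') (hQ' : Q'.map s = -Q') (hT' : T'.map s = T')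
    (h00 : P * P' + Q * N' = 1) (h10 : N * P' + T * N' = 0) (h11 : N * Q' + T * T' = 1) :
    IsUnit T ∧ IsUnit (P - Q * Ring.inverse T * N) := by
  have hu : IsUnit T := hs.isUnit_of_mul_add hT hT' hN hQ' h11
  -- With empty odd blocks the criterion reads `S P' = 1` for the Schur complement `S`.
  refine ⟨hu, hs.isUnit_of_mul_add (l := Fin 0) (Q := 0) (N := 0)
    (map_schur hP hQ hN hT hu) hP' (by ext i j; exact j.elim0) (by ext i; exact i.elim0) ?_⟩
  have h1 : Ring.inverse T * (N * P') = -N' := by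
    rw [eq_neg_of_add_eq_zero_left h10, Matrix.mul_neg, ← Matrix.mul_assoc,
      Ring.inverse_mul_cancel T hu, Matrix.one_mul]
  rw [Matrix.zero_mul, zero_add, Matrix.sub_mul, Matrix.mul_assoc, Matrix.mul_assoc, h1,
    Matrix.mul_neg, sub_neg_eq_add, h00]

/-- The row vector `(a₀, 1 | a₁)` times a matrix with blocks `P, Q, N, T` vanishes on the
columns of `Q, T`; then it can be computed from the Schur complement. -/
theorem schur_row_identity {P : Matrix (Fin (k + 1)) (Fin (k + 1)) R}
    {Q : Matrix (Fin (k + 1)) (Fin p) R} {N : Matrix (Fin p) (Fin (k + 1)) R}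
    {T : Matrix (Fin p) (Fin p) R} (hu : IsUnit T) (a₀ : Fin k → R) (a₁ : Fin p → R)
    (hQT : ∀ l, Q (Fin.last k) l + ∑ i, a₀ i * Q i.castSucc l + ∑ l', a₁ l' * T l' l = 0)
    (j : Fin (k + 1)) :
    (P - Q * Ring.inverse T * N) (Fin.last k) j +
        ∑ i : Fin k, a₀ i * (P - Q * Ring.inverse T * N) i.castSucc j =
      P (Fin.last k) j + ∑ i, a₀ i * P i.castSucc j + ∑ l, a₁ l * N l j := by
  set r : Fin (k + 1) → R := Fin.snoc a₀ 1 with hr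
  have hsum : ∀ {l : ℕ} (M : Matrix (Fin (k + 1)) (Fin l) R) (j : Fin l),
      Matrix.vecMul r M j = M (Fin.last k) j + ∑ i : Fin k, a₀ i * M i.castSucc j := by
    intro l M j
    simp [Matrix.vecMul, dotProduct, Fin.sum_univ_castSucc, hr, add_comm]
  have h1 : Matrix.vecMul r Q = -Matrix.vecMul a₁ T := by
    funext l
    rw [hsum, Pi.neg_apply, eq_neg_iff_add_eq_zero]
    exact hQT l
  rw [← hsum, ← hsum, Matrix.vecMul_sub, ← Matrix.vecMul_vecMul, ← Matrix.vecMul_vecMul, h1,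
    Matrix.neg_vecMul, Matrix.vecMul_vecMul, Ring.mul_inverse_cancel T hu, Matrix.vecMul_one,
    Matrix.neg_vecMul, sub_neg_eq_add]
  rfl

/-- Block elimination carries the row relation of `(a₀, 1 | a₁)` over to the Schur complement, where
only `(a₀, 1)` acts. There `colDet_snoc_col` applies, and `schur_row_identity` identifies the last
factor. -/
theorem IsSuperInvolution.colDet_schur_snoc (hs : IsSuperInvolution s)
    {P : Matrix (Fin (k + 1)) (Fin (k + 1)) R} {Q : Matrix (Fin (k + 1)) (Fin p) R}
    {N : Matrix (Fin p) (Fin (k + 1)) R} {T : Matrix (Fin p) (Fin p) R}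
    (hP : (P.submatrix id Fin.castSucc).map s = P.submatrix id Fin.castSucc)
    (hQ : Q.map s = -Q) (hN : (N.submatrix id Fin.castSucc).map s = -N.submatrix id Fin.castSucc)
    (hT : T.map s = T) (hu : IsUnit T)
    (hS : IsUnit (P.submatrix Fin.castSucc Fin.castSucc -
      Q.submatrix Fin.castSucc id * Ring.inverse T * N.submatrix id Fin.castSucc))
    (a₀ : Fin k → R) (a₁ : Fin p → R)
    (hQT : ∀ l, Q (Fin.last k) l + ∑ i, a₀ i * Q i.castSucc l + ∑ l', a₁ l' * T l' l = 0)
    (hPN : ∀ j : Fin k, P (Fin.last k) j.castSucc + ∑ i, a₀ i * P i.castSucc j.castSucc +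
      ∑ l, a₁ l * N l j.castSucc = 0) :
    colDet (P - Q * Ring.inverse T * N) =
      colDet (P.submatrix Fin.castSucc Fin.castSucc -
        Q.submatrix Fin.castSucc id * Ring.inverse T * N.submatrix id Fin.castSucc) *
      (P (Fin.last k) (Fin.last k) + ∑ i, a₀ i * P i.castSucc (Fin.last k) +
        ∑ l, a₁ l * N l (Fin.last k)) := by
  have hrow := schur_row_identity (P := P) (N := N) hu a₀ a₁ hQT
  have heven : (P.submatrix id Fin.castSucc - Q * Ring.inverse T * N.submatrix id Fin.castSucc).map
      s = P.submatrix id Fin.castSucc - Q * Ring.inverse T * N.submatrix id Fin.castSucc :=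
    map_schur hP hQ hN hT hu
  have hsub : (P - Q * Ring.inverse T * N).submatrix id Fin.castSucc =
      P.submatrix id Fin.castSucc - Q * Ring.inverse T * N.submatrix id Fin.castSucc := rfl
  have hsub' : (P - Q * Ring.inverse T * N).submatrix Fin.castSucc Fin.castSucc =
      P.submatrix Fin.castSucc Fin.castSucc -
      Q.submatrix Fin.castSucc id * Ring.inverse T * N.submatrix id Fin.castSucc := rfl
  rw [← hsub] at heven
  rw [← hsub'] at hS ⊢
  rw [← hrow]
  generalize P - Q * Ring.inverse T * N = A at *
  obtain ⟨A₀, hA₀⟩ := hs.exists_lift heven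
  have hlast : ∀ j : Fin k, A (Fin.last k) j.castSucc + ∑ i, a₀ i * A i.castSucc j.castSucc = 0 :=
    fun j => (hrow _).trans (hPN j)
  -- The row `a₀` must be central. It solves a linear system with even coefficients and even right
  -- side, and so does `s a₀`; the matrix of the system is invertible.
  have ha₀ : ∀ i, s (a₀ i) = a₀ i := by
    have h1 : Matrix.vecMul a₀ (A.submatrix Fin.castSucc Fin.castSucc) =
        fun j => -A (Fin.last k) j.castSucc := by
      funext j
      rw [← add_eq_zero_iff_eq_neg, add_comm]
      exact hlast j
    have h2 : Matrix.vecMul (fun i => s (a₀ i)) (A.submatrix Fin.castSucc Fin.castSucc) =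
        fun j => -A (Fin.last k) j.castSucc := by
      funext j
      have h3 := congrArg s (congrFun h1 j)
      rw [map_neg, show s (A (Fin.last k) j.castSucc) = A (Fin.last k) j.castSucc from
        map_eq_iff_entries.1 heven (Fin.last k) j, Matrix.vecMul, dotProduct,
        map_sum] at h3
      change ∑ i, s (a₀ i) * A i.castSucc j.castSucc = _
      rw [← h3]
      refine Finset.sum_congr rfl fun i _ => ?_
      rw [map_mul]
      exact congrArg _ (map_eq_iff_entries.1 heven i.castSucc j).symm
    obtain ⟨u, hu'⟩ := hS
    have h4 := congrArg (fun v => Matrix.vecMul v u⁻¹.1) (h2.trans h1.symm)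
    simp only [← hu', Matrix.vecMul_vecMul, Units.mul_inv, Matrix.vecMul_one] at h4
    exact congrFun h4
  exact colDet_snoc_col (A₀ := A₀) (fun i j => congrFun (congrFun hA₀.symm i) j)
    (fun i => ⟨a₀ i, hs.mem_center (ha₀ i)⟩) hlast

/-- The sizes `k'` and `p'` are free because the blocks of a matrix of size `n + 1` have sizes such
as `(n + 2) / 2`, which equal `k + 1` or `p` only after a division by two is evaluated. -/
theorem IsSuperInvolution.colDet_schur_bordered (hs : IsSuperInvolution s) {k' p' : ℕ}
    (hk : k' = k + 1) (hp : p' = p)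
    {P : Matrix (Fin k') (Fin k') R} {Q : Matrix (Fin k') (Fin p') R}
    {N : Matrix (Fin p') (Fin k') R} {T : Matrix (Fin p') (Fin p') R}
    {P₁ : Matrix (Fin k) (Fin k) R} {Q₁ : Matrix (Fin k) (Fin p) R}
    {N₁ : Matrix (Fin p) (Fin k) R} {T₁ : Matrix (Fin p) (Fin p) R}
    (hP : ∀ i j, P (Fin.cast hk.symm (Fin.castSucc i)) (Fin.cast hk.symm (Fin.castSucc j)) = P₁ i j)
    (hQ : ∀ i l, Q (Fin.cast hk.symm (Fin.castSucc i)) (Fin.cast hp.symm l) = Q₁ i l)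
    (hN : ∀ l j, N (Fin.cast hp.symm l) (Fin.cast hk.symm (Fin.castSucc j)) = N₁ l j)
    (hT : ∀ l l', T (Fin.cast hp.symm l) (Fin.cast hp.symm l') = T₁ l l')
    (hP₁ : P₁.map s = P₁) (hQ₁ : Q₁.map s = -Q₁) (hN₁ : N₁.map s = -N₁) (hT₁ : T₁.map s = T₁)
    (hPl : ∀ j, s (P (Fin.cast hk.symm (Fin.last k)) (Fin.cast hk.symm (Fin.castSucc j))) =
      P (Fin.cast hk.symm (Fin.last k)) (Fin.cast hk.symm (Fin.castSucc j)))
    (hQl : ∀ l, s (Q (Fin.cast hk.symm (Fin.last k)) (Fin.cast hp.symm l)) =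
      -Q (Fin.cast hk.symm (Fin.last k)) (Fin.cast hp.symm l))
    (hu : IsUnit T₁) (hS : IsUnit (P₁ - Q₁ * Ring.inverse T₁ * N₁))
    (a₀ : Fin k → R) (a₁ : Fin p → R)
    (hQT : ∀ l, Q (Fin.cast hk.symm (Fin.last k)) (Fin.cast hp.symm l) +
      (∑ i, a₀ i * Q₁ i l + ∑ l', a₁ l' * T₁ l' l) = 0)
    (hPN : ∀ j, P (Fin.cast hk.symm (Fin.last k)) (Fin.cast hk.symm (Fin.castSucc j)) +
      (∑ i, a₀ i * P₁ i j + ∑ l, a₁ l * N₁ l j) = 0) :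
    IsUnit T ∧ colDet T = colDet T₁ ∧ colDet (P - Q * Ring.inverse T * N) =
      colDet (P₁ - Q₁ * Ring.inverse T₁ * N₁) *
      (P (Fin.cast hk.symm (Fin.last k)) (Fin.cast hk.symm (Fin.last k)) +
        (∑ i, a₀ i * P (Fin.cast hk.symm (Fin.castSucc i)) (Fin.cast hk.symm (Fin.last k)) +
        ∑ l, a₁ l * N (Fin.cast hp.symm l) (Fin.cast hk.symm (Fin.last k)))) := by
  subst hk hp
  obtain rfl : T = T₁ := Matrix.ext hT
  obtain rfl : P.submatrix Fin.castSucc Fin.castSucc = P₁ := Matrix.ext hP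
  obtain rfl : Q.submatrix Fin.castSucc id = Q₁ := Matrix.ext hQ
  obtain rfl : N.submatrix id Fin.castSucc = N₁ := Matrix.ext hN
  refine ⟨hu, rfl, ?_⟩
  simp only [← add_assoc] at hQT hPN ⊢
  refine hs.colDet_schur_snoc (map_eq_iff_entries.2 fun i j => ?_)
    (map_eq_neg_iff_entries.2 fun i l => ?_) hN₁ hT₁ hu hS a₀ a₁ hQT hPN
  · refine Fin.lastCases (hPl j) (fun i => ?_) i
    exact map_eq_iff_entries.1 hP₁ i j
  · refine Fin.lastCases (hQl l) (fun i => ?_) i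
    exact map_eq_neg_iff_entries.1 hQ₁ i l

end Schur

/-! ### Berezinians of bordered matrices -/

section Bordered

variable {R : Type*} [Ring R] {s : R →+* R} {n : ℕ}

theorem evIdx_odIdx_bijective (n : ℕ) :
    Function.Bijective (Sum.elim (evIdx n) (odIdx n)) := by
  constructor
  · rintro (i | i) (j | j) h <;>
      simp only [Sum.elim_inl, Sum.elim_inr, evIdx, odIdx, Fin.mk.injEq] at h
    · exact congrArg _ (Fin.ext (by omega))
    · omega
    · omega
    · exact congrArg _ (Fin.ext (by omega))
  · intro i
    rcases Nat.even_or_odd' (i : ℕ) with ⟨c, hc | hc⟩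
    · exact ⟨Sum.inl ⟨c, by omega⟩, Fin.ext hc.symm⟩
    · exact ⟨Sum.inr ⟨c, by omega⟩, Fin.ext hc.symm⟩

theorem sum_evIdx_add_sum_odIdx {M : Type*} [AddCommMonoid M] (f : Fin n → M) :
    ∑ i, f i = ∑ i, f (evIdx n i) + ∑ i, f (odIdx n i) := by
  rw [← (Equiv.ofBijective _ (evIdx_odIdx_bijective n)).sum_comp f, Fintype.sum_sum_type]
  rfl

/-- The entry in row `i` and column `j` has the parity of `i + j`. -/
def IsEvenMatrix (s : R →+* R) (A : Matrix (Fin n) (Fin n) R) : Prop :=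
  ∀ i j, s (A i j) = (-1) ^ ((i : ℕ) + j) * A i j

theorem IsEvenMatrix.block00 {A : Matrix (Fin n) (Fin n) R} (h : IsEvenMatrix s A) :
    (block00 A).map s = block00 A :=
  map_eq_iff_entries.2 fun i j => (h _ _).trans <| by
    rw [Even.neg_one_pow, one_mul]
    · rfl
    · exact ⟨i + j, by simp only [evIdx]; ring⟩

theorem IsEvenMatrix.block11 {A : Matrix (Fin n) (Fin n) R} (h : IsEvenMatrix s A) :
    (block11 A).map s = block11 A :=
  map_eq_iff_entries.2 fun i j => (h _ _).trans <| by
    rw [Even.neg_one_pow, one_mul]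
    · rfl
    · exact ⟨i + j + 1, by simp only [odIdx]; ring⟩

theorem IsEvenMatrix.block01 {A : Matrix (Fin n) (Fin n) R} (h : IsEvenMatrix s A) :
    (block01 A).map s = -block01 A :=
  map_eq_neg_iff_entries.2 fun i j => (h _ _).trans <| by
    rw [Odd.neg_one_pow, neg_one_mul]
    · rfl
    · exact ⟨i + j, by simp only [evIdx, odIdx]; ring⟩

theorem IsEvenMatrix.block10 {A : Matrix (Fin n) (Fin n) R} (h : IsEvenMatrix s A) :
    (block10 A).map s = -block10 A :=
  map_eq_neg_iff_entries.2 fun i j => (h _ _).trans <| by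
    rw [Odd.neg_one_pow, neg_one_mul]
    · rfl
    · exact ⟨i + j, by simp only [evIdx, odIdx]; ring⟩

/-- Evenness says that `s` acts on the matrix as conjugation by the diagonal matrix of signs
`(-1)ⁱ`, a condition stable under inversion. -/
theorem IsEvenMatrix.of_mul_eq_one {A X : Matrix (Fin n) (Fin n) R} (h : IsEvenMatrix s A)
    (h1 : A * X = 1) (h2 : X * A = 1) : IsEvenMatrix s X := by
  let S : Matrix (Fin n) (Fin n) R := Matrix.diagonal fun i => (-1) ^ (i : ℕ)
  have hSS : S * S = 1 := by
    rw [Matrix.diagonal_mul_diagonal, ← Matrix.diagonal_one]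
    congr 1
    funext i
    rw [← pow_add, Even.neg_one_pow ⟨_, rfl⟩]
  have hconj : ∀ (M : Matrix (Fin n) (Fin n) R) i j, (S * M * S) i j =
      (-1) ^ ((i : ℕ) + j) * M i j := by
    intro M i j
    rw [Matrix.mul_diagonal, Matrix.diagonal_mul, mul_assoc, pow_add, mul_assoc]
    congr 1
    exact ((Commute.neg_one_left (M i j)).pow_left _).eq.symm
  have hA : s.mapMatrix A = S * A * S := by
    ext i j
    rw [hconj]
    exact h i j
  have h3 : S * A * S * s.mapMatrix X = 1 := by rw [← hA, ← map_mul, h1, map_one]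
  have h4 : A * (S * s.mapMatrix X * S) = 1 := by
    calc _ = S * (S * A * S * s.mapMatrix X) * S := by
          simp only [← mul_assoc, hSS, one_mul]
      _ = 1 := by rw [h3, mul_one, hSS]
  have h5 := left_inv_eq_right_inv h2 h4
  intro i j
  have h6 : s.mapMatrix X = S * X * S := by
    calc _ = (S * S) * s.mapMatrix X * (S * S) := by rw [hSS, one_mul, mul_one]
      _ = S * (S * s.mapMatrix X * S) * S := by simp only [mul_assoc]
      _ = _ := by rw [← h5]
  exact (congrFun (congrFun h6 i) j).trans (hconj X i j)

theorem IsSuperInvolution.isUnit_blocks (hs : IsSuperInvolution s) {A : Matrix (Fin n) (Fin n) R}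
    (h : IsEvenMatrix s A) (hu : IsUnit A) :
    (IsUnit (block11 A) ∧
      IsUnit (block00 A - block01 A * Ring.inverse (block11 A) * block10 A)) ∧
    (IsUnit (block00 A) ∧
      IsUnit (block11 A - block10 A * Ring.inverse (block00 A) * block01 A)) := by
  obtain ⟨⟨A, X, h1, h2⟩, rfl⟩ := hu
  have hX := h.of_mul_eq_one h1 h2
  have hsplit : ∀ i j, (1 : Matrix (Fin n) (Fin n) R) i j =
      ∑ l, A i (evIdx n l) * X (evIdx n l) j + ∑ l, A i (odIdx n l) * X (odIdx n l) j := by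
    intro i j
    rw [← h1, Matrix.mul_apply, sum_evIdx_add_sum_odIdx]
  have hne : ∀ i j, evIdx n i ≠ odIdx n j := fun i j e => by
    have := congrArg Fin.val e
    simp only [evIdx, odIdx] at this
    omega
  have he : Function.Injective (evIdx n) := fun i j e => Fin.ext (by
    have := congrArg Fin.val e
    simp only [evIdx] at this
    omega)
  have ho : Function.Injective (odIdx n) := fun i j e => Fin.ext (by
    have := congrArg Fin.val e
    simp only [odIdx] at this
    omega)
  have h00 : Superline.block00 A * Superline.block00 X +
      Superline.block01 A * Superline.block10 X = 1 := by
    ext i j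
    refine (hsplit (evIdx n i) (evIdx n j)).symm.trans ?_
    simp only [Matrix.one_apply, he.eq_iff]
  have h01 : Superline.block00 A * Superline.block01 X +
      Superline.block01 A * Superline.block11 X = 0 := by
    ext i j
    exact (hsplit (evIdx n i) (odIdx n j)).symm.trans (Matrix.one_apply_ne (hne i j))
  have h10 : Superline.block10 A * Superline.block00 X +
      Superline.block11 A * Superline.block10 X = 0 := by
    ext i j
    exact (hsplit (odIdx n i) (evIdx n j)).symm.trans (Matrix.one_apply_ne (hne j i).symm)
  have h11 : Superline.block10 A * Superline.block01 X +
      Superline.block11 A * Superline.block11 X = 1 := by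
    ext i j
    refine (hsplit (odIdx n i) (odIdx n j)).symm.trans ?_
    simp only [Matrix.one_apply, ho.eq_iff]
  exact ⟨hs.isUnit_schur h.block00 h.block01 h.block10 h.block11 hX.block00 hX.block01 hX.block11
      h00 h10 h11,
    hs.isUnit_schur h.block11 h.block10 h.block01 h.block00 hX.block11 hX.block10 hX.block00
      ((add_comm _ _).trans h11)
      ((add_comm _ _).trans h01) ((add_comm _ _).trans h00)⟩

/-- `A` is obtained from `W` by adding a row of the parity of its number and an arbitrary
column, and `(a, 1)` is orthogonal to all columns of `A` but the last one. -/
structure IsBordered (s : R →+* R) (W : Matrix (Fin n) (Fin n) R) (a : Fin n → R)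
    (A : Matrix (Fin (n + 1)) (Fin (n + 1)) R) : Prop where
  castSucc_castSucc : ∀ i j : Fin n, A i.castSucc j.castSucc = W i j
  parity_last : ∀ j : Fin n, s (A (Fin.last n) j.castSucc) =
    (-1) ^ (n + (j : ℕ)) * A (Fin.last n) j.castSucc
  last_add_sum : ∀ j : Fin n, A (Fin.last n) j.castSucc + ∑ i, a i * W i j = 0

/-- The new index `n` is even, so bordering enlarges the even blocks and leaves the odd-odd block as
it was. The unit `d` is chosen before `a` and `A`, so one `d` serves the Wronskian and all its
cofactors. -/
theorem IsSuperInvolution.ber_bordered (hs : IsSuperInvolution s) (hn : Even n)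
    {W : Matrix (Fin n) (Fin n) R} (hW : IsEvenMatrix s W) (hu : IsUnit W) :
    IsUnit (block11 W) ∧ ∃ d : (Subring.center R)ˣ, ber W = ((d : Subring.center R) : R) ∧
      ∀ (a : Fin n → R) (A : Matrix (Fin (n + 1)) (Fin (n + 1)) R), IsBordered s W a A →
        IsUnit (block11 A) ∧ ber A = ((d : Subring.center R) : R) *
          (A (Fin.last n) (Fin.last n) + ∑ i, a i * A i.castSucc (Fin.last n)) := by
  obtain ⟨h11, hS⟩ := (hs.isUnit_blocks hW hu).1
  obtain ⟨d₁, hd₁⟩ := hs.exists_colDet_eq_unit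
    (map_schur hW.block00 hW.block01 hW.block10 hW.block11 h11) hS
  obtain ⟨d₂, hd₂⟩ := hs.exists_colDet_eq_unit hW.block11 h11
  have hinv : Ring.inverse (((d₂ : Subring.center R) : R)) =
      (((d₂⁻¹ : (Subring.center R)ˣ) : Subring.center R) : R) :=
    Ring.inverse_unit (Units.map (Subring.center R).subtype.toMonoidHom d₂)
  refine ⟨h11, d₁ * d₂⁻¹, by rw [ber, hd₁, hd₂, hinv]; rfl, fun a A hA => ?_⟩
  obtain ⟨m, rfl⟩ := hn
  have hk : (m + m + 1 + 1) / 2 = (m + m + 1) / 2 + 1 := by omega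
  have hp : (m + m + 1) / 2 = (m + m) / 2 := by omega
  have hev : ∀ i, evIdx (m + m + 1) (Fin.cast hk.symm (Fin.castSucc i)) =
      (evIdx (m + m) i).castSucc := fun i => rfl
  have hod : ∀ i, odIdx (m + m + 1) (Fin.cast hp.symm i) = (odIdx (m + m) i).castSucc :=
    fun i => rfl
  have hlast : evIdx (m + m + 1) (Fin.cast hk.symm (Fin.last _)) = Fin.last (m + m) :=
    Fin.ext (by simp only [evIdx, Fin.val_cast, Fin.val_last]; omega)
  obtain ⟨hAu, hAd, hAS⟩ := hs.colDet_schur_bordered hk hp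
    (P := block00 A) (Q := block01 A) (N := block10 A) (T := block11 A)
    (P₁ := block00 W) (Q₁ := block01 W) (N₁ := block10 W) (T₁ := block11 W)
    (fun i j => hA.castSucc_castSucc (evIdx _ i) (evIdx _ j))
    (fun i j => hA.castSucc_castSucc (evIdx _ i) (odIdx _ j))
    (fun i j => hA.castSucc_castSucc (odIdx _ i) (evIdx _ j))
    (fun i j => hA.castSucc_castSucc (odIdx _ i) (odIdx _ j))
    hW.block00 hW.block01 hW.block10 hW.block11
    (fun j => by
      simp only [block00, Matrix.submatrix_apply, hlast, hev]
      rw [hA.parity_last, Even.neg_one_pow, one_mul]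
      exact ⟨m + j, by simp only [evIdx]; ring⟩)
    (fun j => by
      simp only [block01, Matrix.submatrix_apply, hlast, hod]
      rw [hA.parity_last, Odd.neg_one_pow, neg_one_mul]
      exact ⟨m + j, by simp only [odIdx]; ring⟩)
    h11 hS (fun i => a (evIdx _ i)) (fun i => a (odIdx _ i))
    (fun j => by
      simp only [block01, block11, Matrix.submatrix_apply, hlast, hod]
      rw [← sum_evIdx_add_sum_odIdx fun i => a i * W i (odIdx _ j)]
      exact hA.last_add_sum _)
    (fun j => by
      simp only [block00, block10, Matrix.submatrix_apply, hlast, hev]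
      rw [← sum_evIdx_add_sum_odIdx fun i => a i * W i (evIdx _ j)]
      exact hA.last_add_sum _)
  refine ⟨hAu, ?_⟩
  simp only [block00, block10, Matrix.submatrix_apply, hlast, hev, hod] at hAS
  rw [← sum_evIdx_add_sum_odIdx fun i => a i * A i.castSucc (Fin.last _)] at hAS
  refine (congrArg₂ (· * ·) hAS (congrArg Ring.inverse hAd)).trans ?_
  simp only [hd₂, hinv]
  refine (congrArg (fun x => x * _ * _) hd₁).trans ?_
  -- The central factor `d₂⁻¹` is moved past the last factor, whose parity is arbitrary.
  rw [mul_assoc, Subring.mem_center_iff.1 ((d₂⁻¹ : (Subring.center R)ˣ) : Subring.center R).2,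
    ← mul_assoc]
  rfl

/-- The parity-reversed case: the new index is odd, so the odd blocks grow and the even-even block
is unchanged. -/
theorem IsSuperInvolution.berStar_bordered (hs : IsSuperInvolution s) (hn : Odd n)
    {W : Matrix (Fin n) (Fin n) R} (hW : IsEvenMatrix s W) (hu : IsUnit W) :
    IsUnit (block00 W) ∧ ∃ d : (Subring.center R)ˣ, berStar W = ((d : Subring.center R) : R) ∧
      ∀ (a : Fin n → R) (A : Matrix (Fin (n + 1)) (Fin (n + 1)) R), IsBordered s W a A →
        IsUnit (block00 A) ∧ berStar A = ((d : Subring.center R) : R) *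
          (A (Fin.last n) (Fin.last n) + ∑ i, a i * A i.castSucc (Fin.last n)) := by
  obtain ⟨h00, hS⟩ := (hs.isUnit_blocks hW hu).2
  obtain ⟨d₁, hd₁⟩ := hs.exists_colDet_eq_unit
    (map_schur hW.block11 hW.block10 hW.block01 hW.block00 h00) hS
  obtain ⟨d₂, hd₂⟩ := hs.exists_colDet_eq_unit hW.block00 h00
  have hinv : Ring.inverse (((d₂ : Subring.center R) : R)) =
      (((d₂⁻¹ : (Subring.center R)ˣ) : Subring.center R) : R) :=
    Ring.inverse_unit (Units.map (Subring.center R).subtype.toMonoidHom d₂)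
  refine ⟨h00, d₁ * d₂⁻¹, by rw [berStar, hd₁, hd₂, hinv]; rfl, fun a A hA => ?_⟩
  obtain ⟨m, rfl⟩ := hn
  have hk : (2 * m + 1 + 1) / 2 = (2 * m + 1) / 2 + 1 := by omega
  have hp : (2 * m + 1 + 1 + 1) / 2 = (2 * m + 1 + 1) / 2 := by omega
  have hod : ∀ i, odIdx (2 * m + 1 + 1) (Fin.cast hk.symm (Fin.castSucc i)) =
      (odIdx (2 * m + 1) i).castSucc := fun i => rfl
  have hev : ∀ i, evIdx (2 * m + 1 + 1) (Fin.cast hp.symm i) = (evIdx (2 * m + 1) i).castSucc :=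
    fun i => rfl
  have hlast : odIdx (2 * m + 1 + 1) (Fin.cast hk.symm (Fin.last _)) = Fin.last (2 * m + 1) :=
    Fin.ext (by simp only [odIdx, Fin.val_cast, Fin.val_last]; omega)
  obtain ⟨hAu, hAd, hAS⟩ := hs.colDet_schur_bordered hk hp
    (P := block11 A) (Q := block10 A) (N := block01 A) (T := block00 A)
    (P₁ := block11 W) (Q₁ := block10 W) (N₁ := block01 W) (T₁ := block00 W)
    (fun i j => hA.castSucc_castSucc (odIdx _ i) (odIdx _ j))
    (fun i j => hA.castSucc_castSucc (odIdx _ i) (evIdx _ j))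
    (fun i j => hA.castSucc_castSucc (evIdx _ i) (odIdx _ j))
    (fun i j => hA.castSucc_castSucc (evIdx _ i) (evIdx _ j))
    hW.block11 hW.block10 hW.block01 hW.block00
    (fun j => by
      simp only [block11, Matrix.submatrix_apply, hlast, hod]
      rw [hA.parity_last, Even.neg_one_pow, one_mul]
      exact ⟨m + j + 1, by simp only [odIdx]; ring⟩)
    (fun j => by
      simp only [block10, Matrix.submatrix_apply, hlast, hev]
      rw [hA.parity_last, Odd.neg_one_pow, neg_one_mul]
      exact ⟨m + j, by simp only [evIdx]; ring⟩)
    h00 hS (fun i => a (odIdx _ i)) (fun i => a (evIdx _ i))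
    (fun j => by
      simp only [block10, block00, Matrix.submatrix_apply, hlast, hev]
      rw [add_comm (∑ _, _), ← sum_evIdx_add_sum_odIdx fun i => a i * W i (evIdx _ j)]
      exact hA.last_add_sum _)
    (fun j => by
      simp only [block11, block01, Matrix.submatrix_apply, hlast, hod]
      rw [add_comm (∑ _, _), ← sum_evIdx_add_sum_odIdx fun i => a i * W i (odIdx _ j)]
      exact hA.last_add_sum _)
  refine ⟨hAu, ?_⟩
  simp only [block11, block01, Matrix.submatrix_apply, hlast, hod, hev] at hAS
  rw [add_comm (∑ _, _), ← sum_evIdx_add_sum_odIdx fun i => a i * A i.castSucc (Fin.last _)] at hAS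
  refine (congrArg₂ (· * ·) hAS (congrArg Ring.inverse hAd)).trans ?_
  simp only [hd₂, hinv]
  refine (congrArg (fun x => x * _ * _) hd₁).trans ?_
  rw [mul_assoc, Subring.mem_center_iff.1 ((d₂⁻¹ : (Subring.center R)ˣ) : Subring.center R).2,
    ← mul_assoc]
  rfl

end Bordered

/-! ### The superalgebra of functions -/

section Parity

variable {B : Type*} [Ring B] [Algebra ℝ B] (𝒜 : ZMod 2 → Submodule ℝ B) [GradedAlgebra 𝒜]

theorem proj_zero_add_proj_one (b : B) :
    GradedAlgebra.proj 𝒜 0 b + GradedAlgebra.proj 𝒜 1 b = b := by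
  classical
  have h := DirectSum.sum_support_decompose 𝒜 b
  rw [Finset.sum_subset (Finset.subset_univ _) fun i _ hi => by
    rw [DFinsupp.notMem_support_iff.1 hi, ZeroMemClass.coe_zero]] at h
  exact (Fin.sum_univ_two fun i : Fin 2 => GradedAlgebra.proj 𝒜 (i : ZMod 2) b).symm.trans h

theorem mem_even_iff {b : B} : b ∈ 𝒜 0 ↔ parityInv 𝒜 b = b := by
  refine ⟨parityInv_of_even 𝒜, fun h => ?_⟩
  have h1 := proj_zero_add_proj_one 𝒜 b
  have h2 : (2 : ℝ) • b = (2 : ℝ) • GradedAlgebra.proj 𝒜 0 b := by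
    calc (2 : ℝ) • b = parityInv 𝒜 b + (GradedAlgebra.proj 𝒜 0 b + GradedAlgebra.proj 𝒜 1 b) := by
          rw [h, h1, two_smul]
      _ = _ := by rw [parityInv, LinearMap.sub_apply, two_smul]; abel
  rw [smul_right_injective B (two_ne_zero (α := ℝ)) h2]
  exact SetLike.coe_mem _

theorem mem_odd_iff {b : B} : b ∈ 𝒜 1 ↔ parityInv 𝒜 b = -b := by
  refine ⟨parityInv_of_odd 𝒜, fun h => ?_⟩
  have h1 := proj_zero_add_proj_one 𝒜 b
  have h2 : (2 : ℝ) • b = (2 : ℝ) • GradedAlgebra.proj 𝒜 1 b := by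
    calc (2 : ℝ) • b = (GradedAlgebra.proj 𝒜 0 b + GradedAlgebra.proj 𝒜 1 b) - parityInv 𝒜 b := by
          rw [h, h1, two_smul, sub_neg_eq_add]
      _ = _ := by rw [parityInv, LinearMap.sub_apply, two_smul]; abel
  rw [smul_right_injective B (two_ne_zero (α := ℝ)) h2]
  exact SetLike.coe_mem _

variable [TopologicalSpace B] [IsParamSuperalgebra 𝒜]

theorem mul_comm_of_even {a : B} (ha : a ∈ 𝒜 0) (b : B) : b * a = a * b := by
  have h0 : GradedAlgebra.proj 𝒜 0 b ∈ 𝒜 0 := SetLike.coe_mem _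
  have h1 : GradedAlgebra.proj 𝒜 1 b ∈ 𝒜 1 := SetLike.coe_mem _
  have e0 := IsParamSuperalgebra.supercomm (𝒜 := 𝒜) _ _ _ _ h0 ha
  have e1 := IsParamSuperalgebra.supercomm (𝒜 := 𝒜) _ _ _ _ h1 ha
  simp only [ZMod.val_zero, mul_zero, pow_zero, one_mul] at e0 e1
  rw [← proj_zero_add_proj_one 𝒜 b, add_mul, mul_add, e0, e1]

theorem mul_comm_of_odd {a : B} (ha : a ∈ 𝒜 1) (b : B) : a * b = parityInv 𝒜 b * a := by
  have h0 : GradedAlgebra.proj 𝒜 0 b ∈ 𝒜 0 := SetLike.coe_mem _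
  have h1 : GradedAlgebra.proj 𝒜 1 b ∈ 𝒜 1 := SetLike.coe_mem _
  have e0 := mul_comm_of_even 𝒜 h0 a
  have e1 := IsParamSuperalgebra.supercomm (𝒜 := 𝒜) _ _ _ _ ha h1
  have hv : (1 : ZMod 2).val = 1 := rfl
  rw [hv, mul_one, pow_one, neg_one_mul] at e1
  rw [← proj_zero_add_proj_one 𝒜 b, map_add, parityInv_of_even 𝒜 h0, parityInv_of_odd 𝒜 h1,
    mul_add, add_mul, e0, e1, neg_mul]

end Parity

/-! ### Parity of functions and the parity pattern of Wroński matrices -/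

section FunctionParity

variable {B : Type*} [Ring B] [Algebra ℝ B] [TopologicalSpace B] [IsTopologicalRing B]
  [ContinuousSMul ℝ B] {𝒜 : ZMod 2 → Submodule ℝ B} [GradedAlgebra 𝒜] [IsParamSuperalgebra 𝒜]
  {I : TopologicalSpace.Opens ℝ} {n : ℕ}

/-- The parity involution of the algebra of functions on the superline. -/
def SFun.parityHom : SFun 𝒜 I →+* SFun 𝒜 I where
  toFun f := ⟨bar 𝒜 f.c0, -bar 𝒜 f.c1⟩
  map_one' := by ext1 <;> simp
  map_mul' f g := by
    ext1
    · simp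
    · simp only [SFun.mul_c1, map_add, map_mul]
      noncomm_ring
  map_zero' := by ext1 <;> simp
  map_add' f g := by
    ext1
    · simp
    · simp only [SFun.add_c1, map_add, neg_add]

theorem SFun.ext_iff_apply {f g : SFun 𝒜 I} :
    f = g ↔ ∀ x, (f.c0 : I → B) x = (g.c0 : I → B) x ∧ (f.c1 : I → B) x = (g.c1 : I → B) x := by
  constructor
  · rintro rfl x
    exact ⟨rfl, rfl⟩
  · intro h
    ext x
    · exact (h x).1
    · exact (h x).2

theorem SFun.hasParity_zero_iff {f : SFun 𝒜 I} : f.HasParity 0 ↔ SFun.parityHom f = f := by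
  rw [SFun.ext_iff_apply]
  refine forall_congr' fun x => and_congr (mem_even_iff 𝒜) ?_
  rw [zero_add, mem_odd_iff]
  exact neg_eq_iff_eq_neg.symm

theorem SFun.hasParity_one_iff {f : SFun 𝒜 I} : f.HasParity 1 ↔ SFun.parityHom f = -f := by
  rw [SFun.ext_iff_apply]
  refine forall_congr' fun x => and_congr (mem_odd_iff 𝒜) ?_
  rw [show (1 : ZMod 2) + 1 = 0 from rfl, mem_even_iff]
  exact neg_inj.symm

theorem SFun.hasParity_natCast_iff {f : SFun 𝒜 I} (i : ℕ) :
    f.HasParity (i : ZMod 2) ↔ SFun.parityHom f = (-1) ^ i * f := by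
  rcases Nat.even_or_odd i with hi | hi
  · rw [(ZMod.natCast_eq_zero_iff_even).2 hi, hi.neg_one_pow, one_mul, SFun.hasParity_zero_iff]
  · rw [(ZMod.natCast_eq_one_iff_odd).2 hi, hi.neg_one_pow, neg_one_mul, SFun.hasParity_one_iff]

theorem SFun.isSuperInvolution_parityHom :
    IsSuperInvolution (SFun.parityHom : SFun 𝒜 I →+* SFun 𝒜 I) where
  eq_zero_of_add_self f h := by
    have hB : ∀ b : B, b + b = 0 → b = 0 := fun b hb => by
      rw [← two_smul ℝ] at hb
      exact (smul_eq_zero_iff_right two_ne_zero).1 hb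
    rw [SFun.ext_iff_apply] at h ⊢
    exact fun x => ⟨hB _ (h x).1, hB _ (h x).2⟩
  even_comm f hf g := by
    rw [← SFun.hasParity_zero_iff] at hf
    rw [SFun.ext_iff_apply]
    intro x
    obtain ⟨h0, h1⟩ := hf x
    rw [zero_add] at h1
    refine ⟨mul_comm_of_even 𝒜 h0 _, ?_⟩
    change (g.c1 : I → B) x * (f.c0 : I → B) x + parityInv 𝒜 ((g.c0 : I → B) x) *
      (f.c1 : I → B) x = (f.c1 : I → B) x * (g.c0 : I → B) x +
        parityInv 𝒜 ((f.c0 : I → B) x) * (g.c1 : I → B) x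
    rw [mul_comm_of_even 𝒜 h0, mul_comm_of_odd 𝒜 h1, parityInv_of_even 𝒜 h0, add_comm]
  odd_anticomm f g hf hg := by
    rw [← SFun.hasParity_one_iff] at hf hg
    rw [SFun.ext_iff_apply]
    intro x
    obtain ⟨h0, h1⟩ := hf x
    obtain ⟨k0, k1⟩ := hg x
    rw [show (1 : ZMod 2) + 1 = 0 from rfl] at h1 k1
    constructor
    · change (f.c0 : I → B) x * (g.c0 : I → B) x = -((g.c0 : I → B) x * (f.c0 : I → B) x)
      rw [mul_comm_of_odd 𝒜 h0, parityInv_of_odd 𝒜 k0, neg_mul]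
    · change (f.c1 : I → B) x * (g.c0 : I → B) x + parityInv 𝒜 ((f.c0 : I → B) x) *
        (g.c1 : I → B) x = -((g.c1 : I → B) x * (f.c0 : I → B) x +
          parityInv 𝒜 ((g.c0 : I → B) x) * (f.c1 : I → B) x)
      rw [parityInv_of_odd 𝒜 h0, parityInv_of_odd 𝒜 k0, neg_mul, neg_mul,
        mul_comm_of_even 𝒜 k1, mul_comm_of_even 𝒜 h1]
      abel

variable [T2Space B]

/-- `D` is odd: it exchanges the two components, while the parity involution puts a sign on just one
of them. -/
theorem parityHom_superD (f : SFun 𝒜 I) :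
    SFun.parityHom (superD 𝒜 I f) = -superD 𝒜 I (SFun.parityHom f) := by
  ext1
  · exact (neg_neg _).symm
  · have h : der (bar 𝒜 f.c0) = bar 𝒜 (der f.c0) :=
      der_eq ((hasDer_der f.c0).map (parityInv 𝒜) (continuous_parityInv 𝒜))
    change -bar 𝒜 (der f.c0) = -der (bar 𝒜 f.c0)
    rw [h]

theorem parityHom_superD_pow (i : ℕ) (f : SFun 𝒜 I) :
    SFun.parityHom ((superD 𝒜 I ^ i) f) = (-1) ^ i * (superD 𝒜 I ^ i) (SFun.parityHom f) := by
  induction i with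
  | zero => simp
  | succ i ih =>
    rw [superD_pow_succ_apply, parityHom_superD, ih, superD_pow_succ_apply]
    rcases Nat.even_or_odd i with hi | hi
    · rw [hi.neg_one_pow, hi.add_one.neg_one_pow, one_mul, neg_one_mul]
    · rw [hi.neg_one_pow, hi.add_one.neg_one_pow, one_mul, neg_one_mul, map_neg, neg_neg]

theorem parityHom_superD_pow_of_hasParity {i j : ℕ} {f : SFun 𝒜 I}
    (hf : f.HasParity (j : ZMod 2)) :
    SFun.parityHom ((superD 𝒜 I ^ i) f) = (-1) ^ (i + j) * (superD 𝒜 I ^ i) f := by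
  rw [parityHom_superD_pow, (SFun.hasParity_natCast_iff j).1 hf, pow_add, mul_assoc]
  congr 1
  rcases Nat.even_or_odd j with hj | hj
  · rw [hj.neg_one_pow, one_mul, one_mul]
  · rw [hj.neg_one_pow, neg_one_mul, neg_one_mul, map_neg]

theorem isEvenMatrix_wronskiMatrix {φ : Fin n → SFun 𝒜 I}
    (hφ : ∀ i : Fin n, (φ i).HasParity ((i : ℕ) : ZMod 2)) :
    IsEvenMatrix SFun.parityHom (wronskiMatrix φ) :=
  fun _ j => parityHom_superD_pow_of_hasParity (hφ j)

theorem isBordered_of_mem_ker {a φ : Fin n → SFun 𝒜 I} (hker : ∀ j, monicOp a (φ j) = 0)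
    (hφ : ∀ i : Fin n, (φ i).HasParity ((i : ℕ) : ZMod 2))
    {A : Matrix (Fin (n + 1)) (Fin (n + 1)) (SFun 𝒜 I)}
    (hA : ∀ i (j : Fin n), A i j.castSucc = (superD 𝒜 I ^ (i : ℕ)) (φ j)) :
    IsBordered SFun.parityHom (wronskiMatrix φ) a A where
  castSucc_castSucc i j := hA _ j
  parity_last j := by
    rw [hA]
    exact parityHom_superD_pow_of_hasParity (hφ j)
  last_add_sum j := by
    rw [hA]
    have h := vecMul_wronskiMatrix_of_mem_ker hker j
    rw [Matrix.vecMul, dotProduct] at h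
    rw [h]
    exact add_neg_cancel _

theorem wronskiMatrix_snoc_castSucc (φ : Fin n → SFun 𝒜 I) (ψ : SFun 𝒜 I) (i : Fin (n + 1))
    (j : Fin n) : wronskiMatrix (Fin.snoc φ ψ : Fin (n + 1) → SFun 𝒜 I) i j.castSucc =
      (superD 𝒜 I ^ (i : ℕ)) (φ j) := by
  rw [wronskiMatrix_apply, Fin.snoc_castSucc]

theorem cofMatrix_castSucc (φ : Fin n → SFun 𝒜 I) (l i : Fin (n + 1)) (j : Fin n) :
    cofMatrix φ l i j.castSucc = (superD 𝒜 I ^ (i : ℕ)) (φ j) := by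
  rw [cofMatrix, Matrix.updateCol_ne (Fin.castSucc_ne_last j), wronskiMatrix_snoc_castSucc]

theorem monicOp_eq_last_add_sum (a φ : Fin n → SFun 𝒜 I) (ψ : SFun 𝒜 I) :
    monicOp a ψ = wronskiMatrix (Fin.snoc φ ψ : Fin (n + 1) → SFun 𝒜 I) (Fin.last n) (Fin.last n) +
      ∑ i, a i * wronskiMatrix (Fin.snoc φ ψ : Fin (n + 1) → SFun 𝒜 I) i.castSucc (Fin.last n) := by
  simp only [wronskiMatrix_apply, Fin.snoc_last, monicOp_apply, Fin.val_last, Fin.val_castSucc]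

/-- Pairing `(a, 1)` with the `l`-th unit vector gives `aₗ` for `l < n` and `1` for `l = n`, the
coefficients of the operator. In this form `IsBordered` matrices recover them one by one. -/
theorem monicOp_eq_sum_cofMatrix (a φ : Fin n → SFun 𝒜 I) (f : SFun 𝒜 I) :
    monicOp a f = ∑ l : Fin (n + 1), (cofMatrix φ l (Fin.last n) (Fin.last n) +
      ∑ i, a i * cofMatrix φ l i.castSucc (Fin.last n)) * (superD 𝒜 I ^ (l : ℕ)) f := by
  have h : ∀ l i, cofMatrix φ l i (Fin.last n) = (Pi.single l 1 : Fin (n + 1) → SFun 𝒜 I) i :=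
    fun l i => by rw [cofMatrix, Matrix.updateCol_self]
  simp only [h]
  rw [Fin.sum_univ_castSucc, monicOp_apply, add_comm]
  congr 1
  · refine Finset.sum_congr rfl fun l _ => ?_
    simp [Pi.single_apply, (Fin.castSucc_ne_last _).symm, eq_comm]
  · simp [Fin.castSucc_ne_last]

end FunctionParity

theorem mul_mul_inverse_of_central {R : Type*} [Ring R] (d : (Subring.center R)ˣ) (x : R) :
    ((d : Subring.center R) : R) * x * Ring.inverse ((d : Subring.center R) : R) = x := by
  have h : IsUnit ((d : Subring.center R) : R) := d.isUnit.map (Subring.center R).subtype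
  rw [← Subring.mem_center_iff.1 (d : Subring.center R).2 x, mul_assoc,
    Ring.mul_inverse_cancel _ h, mul_one]

/-! ### Wronskian formulas for a monic operator -/

section WronskianFormula

variable {B : Type*} [Ring B] [Algebra ℝ B] [TopologicalSpace B]
  [IsTopologicalRing B] [ContinuousSMul ℝ B] [T2Space B]
  {𝒜 : ZMod 2 → Submodule ℝ B} [GradedAlgebra 𝒜] [IsParamSuperalgebra 𝒜]
  {I : TopologicalSpace.Opens ℝ} {n : ℕ}

theorem monicOp_eq_wrStar (hn : Odd n) {a φ : Fin n → SFun 𝒜 I}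
    (hker : ∀ j, monicOp a (φ j) = 0) (hφ : ∀ i : Fin n, (φ i).HasParity ((i : ℕ) : ZMod 2))
    (hu : IsUnit (wronskiMatrix φ)) :
    IsUnit (block00 (wronskiMatrix φ)) ∧ IsUnit (wrStar φ) ∧
      (∀ ψ : SFun 𝒜 I,
        IsUnit (block00 (wronskiMatrix (Fin.snoc φ ψ : Fin (n + 1) → SFun 𝒜 I))) ∧
        monicOp a ψ = wrStar (Fin.snoc φ ψ : Fin (n + 1) → SFun 𝒜 I) *
          Ring.inverse (wrStar φ)) ∧
      ∀ f : SFun 𝒜 I, monicOp a f = ∑ i : Fin (n + 1), berStar (cofMatrix φ i) *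
        Ring.inverse (wrStar φ) * (superD 𝒜 I ^ (i : ℕ)) f := by
  obtain ⟨h00, d, hd, h⟩ := SFun.isSuperInvolution_parityHom.berStar_bordered hn
    (isEvenMatrix_wronskiMatrix hφ) hu
  have hw : wrStar φ = ((d : Subring.center (SFun 𝒜 I)) : SFun 𝒜 I) := hd
  refine ⟨h00, ?_, fun ψ => ?_, fun f => ?_⟩
  · rw [hw]
    exact d.isUnit.map (Subring.center (SFun 𝒜 I)).subtype
  · obtain ⟨h1, h2⟩ := h a _ (isBordered_of_mem_ker hker hφ (wronskiMatrix_snoc_castSucc φ ψ))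
    refine ⟨h1, ?_⟩
    rw [hw, wrStar, h2, ← monicOp_eq_last_add_sum, mul_mul_inverse_of_central]
  · rw [monicOp_eq_sum_cofMatrix a φ f]
    refine Finset.sum_congr rfl fun l _ => ?_
    rw [hw, (h a _ (isBordered_of_mem_ker hker hφ (cofMatrix_castSucc φ l))).2,
      mul_mul_inverse_of_central]

theorem monicOp_eq_wr (hn : Even n) {a φ : Fin n → SFun 𝒜 I}
    (hker : ∀ j, monicOp a (φ j) = 0) (hφ : ∀ i : Fin n, (φ i).HasParity ((i : ℕ) : ZMod 2))
    (hu : IsUnit (wronskiMatrix φ)) :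
    IsUnit (block11 (wronskiMatrix φ)) ∧ IsUnit (wr φ) ∧
      (∀ ψ : SFun 𝒜 I,
        IsUnit (block11 (wronskiMatrix (Fin.snoc φ ψ : Fin (n + 1) → SFun 𝒜 I))) ∧
        monicOp a ψ = wr (Fin.snoc φ ψ : Fin (n + 1) → SFun 𝒜 I) * Ring.inverse (wr φ)) ∧
      ∀ f : SFun 𝒜 I, monicOp a f = ∑ i : Fin (n + 1), ber (cofMatrix φ i) *
        Ring.inverse (wr φ) * (superD 𝒜 I ^ (i : ℕ)) f := by
  obtain ⟨h11, d, hd, h⟩ := SFun.isSuperInvolution_parityHom.ber_bordered hn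
    (isEvenMatrix_wronskiMatrix hφ) hu
  have hw : wr φ = ((d : Subring.center (SFun 𝒜 I)) : SFun 𝒜 I) := hd
  refine ⟨h11, ?_, fun ψ => ?_, fun f => ?_⟩
  · rw [hw]
    exact d.isUnit.map (Subring.center (SFun 𝒜 I)).subtype
  · obtain ⟨h1, h2⟩ := h a _ (isBordered_of_mem_ker hker hφ (wronskiMatrix_snoc_castSucc φ ψ))
    refine ⟨h1, ?_⟩
    rw [hw, wr, h2, ← monicOp_eq_last_add_sum, mul_mul_inverse_of_central]
  · rw [monicOp_eq_sum_cofMatrix a φ f]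
    refine Finset.sum_congr rfl fun l _ => ?_
    rw [hw, (h a _ (isBordered_of_mem_ker hker hφ (cofMatrix_castSucc φ l))).2,
      mul_mul_inverse_of_central]

end WronskianFormula

end Superline

theorem mainTheorem3 {B : Type*} [Ring B] [Algebra ℝ B] [UniformSpace B] [IsUniformAddGroup B]
    [IsTopologicalRing B] [ContinuousSMul ℝ B] [T2Space B] [CompleteSpace B]
    (𝒜 : ZMod 2 → Submodule ℝ B) [GradedAlgebra 𝒜] [Superline.IsParamSuperalgebra 𝒜]
    (I : TopologicalSpace.Opens ℝ) (hI : IsConnected (I : Set ℝ)) :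
    (∀ (n n' : ℕ) (M M' : Module.End Bᵐᵒᵖ (Superline.SFun 𝒜 I)),
      Superline.IsMonicOfOrder n M → Superline.IsMonicOfOrder n' M' →
      LinearMap.ker M = LinearMap.ker M' → M = M') ∧
    (∀ (n : ℕ) (M : Module.End Bᵐᵒᵖ (Superline.SFun 𝒜 I)), Superline.IsMonicOfOrder n M →
      ∀ (b : Module.Basis (Fin n) Bᵐᵒᵖ (LinearMap.ker M)) (φ : Fin n → Superline.SFun 𝒜 I),
      (∀ i, φ i = (b i : Superline.SFun 𝒜 I)) →
      (∀ i : Fin n, (φ i).HasParity ((i : ℕ) : ZMod 2)) →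
      (Odd n →
        IsUnit (Superline.block00 (Superline.wronskiMatrix φ)) ∧
        IsUnit (Superline.wrStar φ) ∧
        (∀ ψ : Superline.SFun 𝒜 I, ψ.HasParity 1 →
          IsUnit (Superline.block00
            (Superline.wronskiMatrix (Fin.snoc φ ψ : Fin (n + 1) → Superline.SFun 𝒜 I))) ∧
          M ψ = Superline.wrStar (Fin.snoc φ ψ : Fin (n + 1) → Superline.SFun 𝒜 I) *
            Ring.inverse (Superline.wrStar φ)) ∧
        (∀ f : Superline.SFun 𝒜 I,
          M f = ∑ i : Fin (n + 1), Superline.berStar (Superline.cofMatrix φ i) *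
            Ring.inverse (Superline.wrStar φ) * (Superline.superD 𝒜 I ^ (i : ℕ)) f)) ∧
      (Even n →
        IsUnit (Superline.block11 (Superline.wronskiMatrix φ)) ∧
        IsUnit (Superline.wr φ) ∧
        (∀ ϕ : Superline.SFun 𝒜 I, ϕ.HasParity 0 →
          IsUnit (Superline.block11
            (Superline.wronskiMatrix (Fin.snoc φ ϕ : Fin (n + 1) → Superline.SFun 𝒜 I))) ∧
          M ϕ = Superline.wr (Fin.snoc φ ϕ : Fin (n + 1) → Superline.SFun 𝒜 I) *
            Ring.inverse (Superline.wr φ)) ∧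
        (∀ f : Superline.SFun 𝒜 I,
          M f = ∑ i : Fin (n + 1), Superline.ber (Superline.cofMatrix φ i) *
            Ring.inverse (Superline.wr φ) * (Superline.superD 𝒜 I ^ (i : ℕ)) f))) := by
  refine ⟨fun n n' M M' hM hM' h => Superline.eq_of_ker_eq hI hM hM' h, ?_⟩
  rintro n M ⟨a, hM⟩ b φ hφb hφ
  obtain rfl : M = Superline.monicOp a := hM
  obtain rfl : φ = fun i => (b i : Superline.SFun 𝒜 I) := funext hφb
  have hker : ∀ j, Superline.monicOp a (b j : Superline.SFun 𝒜 I) = 0 := fun j => (b j).2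
  -- The only input from analysis to the second part; the formulas follow from it by algebra.
  have hu := Superline.isUnit_wronskiMatrix_of_basis hI a b
  refine ⟨fun hn => ?_, fun hn => ?_⟩
  · obtain ⟨h1, h2, h3, h4⟩ := Superline.monicOp_eq_wrStar hn hker hφ hu
    exact ⟨h1, h2, fun ψ _ => h3 ψ, h4⟩
  · obtain ⟨h1, h2, h3, h4⟩ := Superline.monicOp_eq_wr hn hker hφ hu
    exact ⟨h1, h2, fun ϕ _ => h3 ϕ, h4⟩
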